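/- **Theorem (Identity for the Serrin problem with Robin boundary conditions).** Let $N\ge 2$ and let $\Omega\subset\mathbb{R}^N$ be an open, connected, bounded (non-empty) set with $C^2$ boundary and outer unit normal $\nu$. Let $\mathcal M=\frac1{N-1}\operatorname{tr}(\nabla\nu)$ be the mean curvature of $\partial\Omega$ (the average of its principal curvatures, positive for balls), where $\nabla\nu(x)$ denotes the differential of $\nu$ along $\partial\Omega$ on the tangent space at $x$, extended by $(\nabla\nu)\nu=0$. Let $\beta\in\mathbb{R}\setminus\{0\}$ and let $u\in C^2(\overline\Omega)$ be a solution of the Robin torsion problem $$\Delta u=N \ \text{ in }\Omega,\qquad \frac{\partial u}{\partial\nu}+\beta u=0\ \text{ on }\partial\Omega .$$ Set $P=\frac12|\nabla u|^2-u$ on $\overline\Omega$, $\nabla^\tau u=\nabla u-\langle\nabla u,\nu\rangle\nu$ on $\partial\Omega$, and $$R=\frac{N|\Omega|}{|\partial\Omega|},\qquad C=-R^2-R\left(\frac{N+1}{\beta}\right),$$ where $|\Omega|$ is the Lebesgue measure of $\Omega$ and $|\partial\Omega|=\mathcal H^{N-1}(\partial\Omega)$. Assume that $u$ also satisfies $$|\nabla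 u|^2+2Nu-2\beta^2u^2+(N-1)\beta u^2\mathcal M=C\quad\text{on }\partial\Omega .$$ Then $P$ is of class $C^2$ in $\Omega$, $\Delta P$ is integrable on $\Omega$, the three boundary integrands below are integrable on $\partial\Omega$, and $$\int_\Omega\Delta P\,dx+\beta\int_{\partial\Omega}\big(\langle\nabla u,\nu\rangle-R\big)^2\,d\mathcal H^{N-1}=-\int_{\partial\Omega}\langle(\nabla\nu)\nabla^\tau u,\nabla^\tau u\rangle\,d\mathcal H^{N-1}-\beta\int_{\partial\Omega}|\nabla^\tau u|^2\,d\mathcal H^{N-1}.$$ -/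

import Mathlib

open MeasureTheory Set Filter Topology
open scoped InnerProductSpace

/-- `Ω` has `C²` boundary: near each boundary point, `Ω` is the region strictly below the graph of a
`C²` function, in a direction given by a unit vector `e`, over the hyperplane orthogonal to `e`. -/
def HasC2Boundary {N : ℕ} (Ω : Set (EuclideanSpace ℝ (Fin N))) : Prop :=
  ∀ x ∈ frontier Ω, ∃ (e : EuclideanSpace ℝ (Fin N)) (g : (ℝ ∙ e)ᗮ → ℝ) (r : ℝ),
    ‖e‖ = 1 ∧ ContDiff ℝ 2 g ∧ 0 < r ∧
      ∀ y ∈ Metric.ball x r, y ∈ Ω ↔ ⟪e, y⟫_ℝ < g ((ℝ ∙ e)ᗮ.orthogonalProjectionOnto y)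

/-- `n` is an outer unit normal to `Ω` at `x`: a unit vector such that rays from `x` in the open
half-space opposite to `n` start inside `Ω`, and rays in the open half-space of `n` start outside
the closure of `Ω`. -/
def IsOuterUnitNormal {N : ℕ} (Ω : Set (EuclideanSpace ℝ (Fin N)))
    (x n : EuclideanSpace ℝ (Fin N)) : Prop :=
  ‖n‖ = 1 ∧ ∀ v : EuclideanSpace ℝ (Fin N),
    (⟪v, n⟫_ℝ < 0 → ∀ᶠ t in 𝓝[>] (0 : ℝ), x + t • v ∈ Ω) ∧
    (0 < ⟪v, n⟫_ℝ → ∀ᶠ t in 𝓝[>] (0 : ℝ), x + t • v ∉ closure Ω)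

/-- There is at most one outer unit normal at a point. -/
theorem IsOuterUnitNormal.unique {N : ℕ} {Ω : Set (EuclideanSpace ℝ (Fin N))}
    {x n m : EuclideanSpace ℝ (Fin N)} (hn : IsOuterUnitNormal Ω x n)
    (hm : IsOuterUnitNormal Ω x m) : n = m := by
  by_contra hne
  have hlt : ⟪n, m⟫_ℝ < 1 := inner_lt_one_iff_real_of_norm_eq_one hn.1 hm.1 |>.2 hne
  have h1 : ⟪m - n, n⟫_ℝ < 0 := by
    rw [inner_sub_left, real_inner_self_eq_norm_sq, hn.1, real_inner_comm]
    linarith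
  have h2 : 0 < ⟪m - n, m⟫_ℝ := by
    rw [inner_sub_left, real_inner_self_eq_norm_sq, hm.1]
    linarith
  obtain ⟨t, ht, ht'⟩ := (((hn.2 _).1 h1).and ((hm.2 _).2 h2)).exists
  exact ht' (subset_closure ht)

open Classical in
/-- The outer unit normal field `ν` of `Ω` (zero where there is no outer unit normal). -/
noncomputable def outerNormal {N : ℕ} (Ω : Set (EuclideanSpace ℝ (Fin N)))
    (x : EuclideanSpace ℝ (Fin N)) : EuclideanSpace ℝ (Fin N) :=
  if h : ∃ n, IsOuterUnitNormal Ω x n then h.choose else 0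

theorem IsOuterUnitNormal.outerNormal_eq {N : ℕ} {Ω : Set (EuclideanSpace ℝ (Fin N))}
    {x n : EuclideanSpace ℝ (Fin N)} (hn : IsOuterUnitNormal Ω x n) : outerNormal Ω x = n := by
  have h : ∃ n, IsOuterUnitNormal Ω x n := ⟨n, hn⟩
  rw [outerNormal, dif_pos h]
  exact h.choose_spec.unique hn

/-- The differential `∇ν` of the outer unit normal along the boundary: it is the derivative of
`ν : ∂Ω → ℝᴺ` on the tangent space `ν(x)ᗮ` (on which that derivative is uniquely determined), and
it sends `ν(x)` to `0`. -/
noncomputable def gradNormal {N : ℕ} (Ω : Set (EuclideanSpace ℝ (Fin N)))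
    (x : EuclideanSpace ℝ (Fin N)) : EuclideanSpace ℝ (Fin N) →L[ℝ] EuclideanSpace ℝ (Fin N) :=
  (fderivWithin ℝ (outerNormal Ω) (frontier Ω) x).comp (ℝ ∙ outerNormal Ω x)ᗮ.starProjection

/-- The mean curvature of `∂Ω`: the average of the `N - 1` principal curvatures, that is `1/(N-1)`
times the trace of the shape operator `∇ν` (so that balls have positive curvature). -/
noncomputable def meanCurvature {N : ℕ} (Ω : Set (EuclideanSpace ℝ (Fin N)))
    (x : EuclideanSpace ℝ (Fin N)) : ℝ :=
  LinearMap.trace ℝ (EuclideanSpace ℝ (Fin N)) (gradNormal Ω x).toLinearMap / ((N : ℝ) - 1)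

/-- The gradient of `u` on the closure of `Ω`, including one-sided values at the boundary. -/
noncomputable def gradClosure {N : ℕ} (Ω : Set (EuclideanSpace ℝ (Fin N)))
    (u : EuclideanSpace ℝ (Fin N) → ℝ) (x : EuclideanSpace ℝ (Fin N)) :
    EuclideanSpace ℝ (Fin N) :=
  gradientWithin u (closure Ω) x

/-- The outer normal derivative `∂u/∂ν = ⟨∇u, ν⟩` on `∂Ω`. -/
noncomputable def normalDeriv {N : ℕ} (Ω : Set (EuclideanSpace ℝ (Fin N)))
    (u : EuclideanSpace ℝ (Fin N) → ℝ) (x : EuclideanSpace ℝ (Fin N)) : ℝ :=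
  ⟪gradClosure Ω u x, outerNormal Ω x⟫_ℝ

/-- The tangential gradient `∇u - ⟨∇u, ν⟩ ν` on `∂Ω`. -/
noncomputable def tangentialGrad {N : ℕ} (Ω : Set (EuclideanSpace ℝ (Fin N)))
    (u : EuclideanSpace ℝ (Fin N) → ℝ) (x : EuclideanSpace ℝ (Fin N)) :
    EuclideanSpace ℝ (Fin N) :=
  gradClosure Ω u x - normalDeriv Ω u x • outerNormal Ω x

/-- `u ∈ C²(closure Ω)` is a classical solution of the Robin torsion problem
`Δu = N` in `Ω`, `∂u/∂ν + β u = 0` on `∂Ω`. -/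
structure IsRobinTorsionSolution {N : ℕ} (Ω : Set (EuclideanSpace ℝ (Fin N))) (β : ℝ)
    (u : EuclideanSpace ℝ (Fin N) → ℝ) : Prop where
  contDiffOn : ContDiffOn ℝ 2 u (closure Ω)
  laplacian_eq : ∀ x ∈ Ω, Laplacian.laplacian u x = N
  robin : ∀ x ∈ frontier Ω, normalDeriv Ω u x + β * u x = 0

/-- The `P`-function `P = |∇u|²/2 - u` on the closure of `Ω`. -/
noncomputable def pFunction {N : ℕ} (Ω : Set (EuclideanSpace ℝ (Fin N)))
    (u : EuclideanSpace ℝ (Fin N) → ℝ) (x : EuclideanSpace ℝ (Fin N)) : ℝ :=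
  (1 / 2) * ‖gradClosure Ω u x‖ ^ 2 - u x

/-- The surface measure on `∂Ω`: the `(N-1)`-dimensional Hausdorff measure, normalized so that it
agrees with Lebesgue measure on hyperplanes, restricted to `∂Ω`. -/
noncomputable def surfaceMeasure {N : ℕ} (Ω : Set (EuclideanSpace ℝ (Fin N))) :
    Measure (EuclideanSpace ℝ (Fin N)) :=
  (Measure.euclideanHausdorffMeasure (N - 1)).restrict (frontier Ω)

/-- The number `R = N |Ω| / |∂Ω|`. -/
noncomputable def refRadius {N : ℕ} (Ω : Set (EuclideanSpace ℝ (Fin N))) : ℝ :=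
  N * (volume : Measure (EuclideanSpace ℝ (Fin N))).real Ω / (surfaceMeasure Ω).real univ

/-! Write `A` for the Hessian of `u`, `q` for the normal derivative, `τ` for the tangential gradient
and `H = (N - 1)M` for the trace of `∇ν`. In `Ω` the gradient of `P` is the field `V = A∇u - ∇u`, so
the divergence theorem turns `∫ ΔP` into the boundary integral of `⟨V, ν⟩ = ⟨Aτ, ν⟩ + q⟨Aν, ν⟩ - q`.
Differentiating the Robin condition along `τ` gives `⟨Aτ, ν⟩ = -⟨(∇ν)τ, τ⟩ - β|τ|²`, which accounts
for the right-hand side of the identity (`IsRobinTorsionSolution.inner_hessClosure_tangentialGrad`).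

The remaining term is `q⟨Aν, ν⟩ = -βu⟨Aν, ν⟩`. It is produced by the tangential divergence theorem
applied to `X = u∇u`: the quantity `Nu + |∇u|² - u⟨Aν, ν⟩ - q² - Huq` has zero integral over the
boundary (`HasC2Boundary.integral_tangentialDefect`). Adding `β` times this quantity and using the
overdetermined condition, the boundary integrand becomes affine in `q`, with coefficients for which
its integral vanishes once `∫ q = N|Ω| = R|∂Ω|`.

Two points need care. `P` involves first derivatives of `u`, so its `C²` regularity requires
interior smoothness of `u`; this follows from a mean value argument with radial mollifiers
(`contDiffOn_of_laplacian_eq_const`). Moreover `V` is only continuous up to the boundary, so the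
divergence theorem is needed for fields that are `C¹` inside and have integrable divergence. Here
`ΔP = tr(A²) - N`, because the third derivatives combine into the gradient of `tr A = N`; hence `ΔP`
extends continuously to the closure.

Both divergence theorems are proved below a graph `{G < 0}` by inserting a cutoff in `G/ε` and
letting `ε → 0`, and then globalized by a partition of unity. The link with Hausdorff measure is an
area formula for graphs, whose density is `|∇G|`. -/

open scoped ENNReal NNReal

/-- A Lipschitz map increases the Euclidean Hausdorff measure by at most a power of its constant. -/
theorem LipschitzOnWith.euclideanHausdorffMeasure_image_le {X Y : Type*} [EMetricSpace X]
    [EMetricSpace Y] [MeasurableSpace X] [BorelSpace X] [MeasurableSpace Y] [BorelSpace Y]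
    {K : ℝ≥0} {f : X → Y} {s : Set X} (h : LipschitzOnWith K f s) (d : ℕ) :
    μHE[d] (f '' s) ≤ (K : ℝ≥0∞) ^ d * μHE[d] s := by
  simp_rw [Measure.euclideanHausdorffMeasure_def, Measure.smul_apply]
  have := h.hausdorffMeasure_image_le (d := d) (by positivity)
  rw [ENNReal.rpow_natCast] at this
  rw [ENNReal.smul_def, ENNReal.smul_def, smul_eq_mul, smul_eq_mul, mul_left_comm]
  gcongr

/-! ### Area formula for maps metrically asymptotic to linear isomorphisms. -/

section AreaFormula

variable {U V : Type*} [NormedAddCommGroup U] [InnerProductSpace ℝ U] [FiniteDimensional ℝ U]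
  [MeasurableSpace U] [BorelSpace U] [MetricSpace V] [MeasurableSpace V] [BorelSpace V]

theorem euclideanHausdorffMeasure_linearMap_image (S : U →L[ℝ] U) (s : Set U) :
    μHE[Module.finrank ℝ U] (S '' s) = ENNReal.ofReal |S.toLinearMap.det| * volume s := by
  rw [InnerProductSpace.euclideanHausdorffMeasure_eq_volume]
  exact Measure.addHaar_image_linearMap _ S.toLinearMap s

/-- Upper bound for the measure of the image under a map that is metrically close to a linear
map. -/
theorem euclideanHausdorffMeasure_image_le_of_dist_le {f : U → V} {S : U →L[ℝ] U}
    (hS : S.toLinearMap.det ≠ 0) {K : ℝ≥0} {s : Set U}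
    (h : ∀ p ∈ s, ∀ q ∈ s, dist (f p) (f q) ≤ K * ‖S (p - q)‖) :
    μHE[Module.finrank ℝ U] (f '' s)
      ≤ (K : ℝ≥0∞) ^ (Module.finrank ℝ U) * (ENNReal.ofReal |S.toLinearMap.det| * volume s) := by
  rw [← euclideanHausdorffMeasure_linearMap_image]
  have hinj : Function.Injective S := by
    exact (LinearEquiv.ofIsUnitDet (f := S.toLinearMap) (v := Module.finBasis ℝ U)
      (v' := Module.finBasis ℝ U) (by rw [LinearMap.det_toMatrix]; exact hS.isUnit)).injective
  -- The set `f '' s` is the image of `S '' s` under `f ∘ S⁻¹`, and the hypothesis says exactly that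
  -- this composition is `K`-Lipschitz there.
  have hL : LipschitzOnWith K (f ∘ Function.invFun S) (S '' s) := by
    apply LipschitzOnWith.of_dist_le_mul
    rintro _ ⟨p, hp, rfl⟩ _ ⟨q, hq, rfl⟩
    simp only [Function.comp_apply, Function.leftInverse_invFun hinj _, dist_eq_norm (S p),
      ← map_sub]
    exact h p hp q hq
  have := hL.euclideanHausdorffMeasure_image_le (Module.finrank ℝ U)
  rwa [image_image, image_congr (g := f)] at this
  intro p _
  simp only [Function.comp_apply, Function.leftInverse_invFun hinj _]

/-- Lower bound for the measure of the image under a map that is metrically close to a linear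
map. -/
theorem le_euclideanHausdorffMeasure_image_of_le_dist {f : U → V} (hf : Function.Injective f)
    {S : U →L[ℝ] U} {K : ℝ≥0} {s : Set U}
    (h : ∀ p ∈ s, ∀ q ∈ s, ‖S (p - q)‖ ≤ K * dist (f p) (f q)) :
    ENNReal.ofReal |S.toLinearMap.det| * volume s
      ≤ (K : ℝ≥0∞) ^ (Module.finrank ℝ U) * μHE[Module.finrank ℝ U] (f '' s) := by
  rw [← euclideanHausdorffMeasure_linearMap_image]
  have hL : LipschitzOnWith K (S ∘ Function.invFun f) (f '' s) := by
    apply LipschitzOnWith.of_dist_le_mul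
    rintro _ ⟨p, hp, rfl⟩ _ ⟨q, hq, rfl⟩
    simp only [Function.comp_apply, Function.leftInverse_invFun hf _, dist_eq_norm (S p),
      ← map_sub]
    exact h p hp q hq
  have := hL.euclideanHausdorffMeasure_image_le (Module.finrank ℝ U)
  rwa [image_image, image_congr (g := S)] at this
  intro p _
  simp only [Function.comp_apply, Function.leftInverse_invFun hf _]

/-- Area formula for an embedding which is, near each point, metrically asymptotic to a linear
isomorphism of its domain. -/
theorem comap_euclideanHausdorffMeasure_eq_withDensity {f : U → V} (hf : MeasurableEmbedding f)
    (S : U → U →L[ℝ] U) (hS : ∀ y, (S y).toLinearMap.det ≠ 0)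
    (h : ∀ y, ∀ ε > (0 : ℝ), ∃ r > 0, ∀ p ∈ Metric.closedBall y r, ∀ q ∈ Metric.closedBall y r,
      |dist (f p) (f q) - ‖S y (p - q)‖| ≤ ε * ‖S y (p - q)‖) :
    Measure.comap f μHE[Module.finrank ℝ U]
      = volume.withDensity (fun y => ENNReal.ofReal |(S y).toLinearMap.det|) := by
  set d := Module.finrank ℝ U
  set ρ := Measure.comap f μHE[d] with hρ
  have hρa : ∀ s, ρ s = μHE[d] (f '' s) := fun s => hf.comap_apply _ _
  have upper : ∀ y, ∀ ε > (0 : ℝ), ∃ r > 0, ∀ s ⊆ Metric.closedBall y r,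
      ρ s ≤ ENNReal.ofReal (1 + ε) ^ d * (ENNReal.ofReal |(S y).toLinearMap.det| * volume s) := by
    intro y ε hε
    obtain ⟨r, hr, H⟩ := h y ε hε
    refine ⟨r, hr, fun s hs => ?_⟩
    rw [hρa]
    refine euclideanHausdorffMeasure_image_le_of_dist_le (hS y) fun p hp q hq => ?_
    rw [Real.coe_toNNReal _ (by positivity)]
    have := (abs_le.1 (H p (hs hp) q (hs hq))).2
    linarith
  have lower : ∀ y, ∀ ε > (0 : ℝ), ε < 1 → ∃ r > 0, ∀ s ⊆ Metric.closedBall y r,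
      ENNReal.ofReal |(S y).toLinearMap.det| * volume s ≤ ENNReal.ofReal ((1 - ε)⁻¹) ^ d * ρ s := by
    intro y ε hε hε1
    obtain ⟨r, hr, H⟩ := h y ε hε
    refine ⟨r, hr, fun s hs => ?_⟩
    rw [hρa]
    refine le_euclideanHausdorffMeasure_image_of_le_dist hf.injective fun p hp q hq => ?_
    have h1 : (0 : ℝ) < 1 - ε := by linarith
    rw [Real.coe_toNNReal _ (by positivity), inv_mul_eq_div, le_div_iff₀ h1]
    have := (abs_le.1 (H p (hs hp) q (hs hq))).1
    linarith
  have hfin : IsLocallyFiniteMeasure ρ := by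
    refine ⟨fun y => ?_⟩
    obtain ⟨r, hr, H⟩ := upper y 1 one_pos
    refine ⟨Metric.closedBall y r, Metric.closedBall_mem_nhds y hr,
      (H _ subset_rfl).trans_lt ?_⟩
    exact ENNReal.mul_lt_top (by finiteness)
      (ENNReal.mul_lt_top (by finiteness) measure_closedBall_lt_top)
  have hac : ρ ≪ volume := by
    intro s hs
    -- A crude local bound suffices for absolute continuity, so the value `1` of `ε` is as good as
    -- any.
    refine measure_null_of_locally_null s fun y _ => ?_
    obtain ⟨r, hr, H⟩ := upper y 1 one_pos
    refine ⟨s ∩ Metric.closedBall y r,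
      inter_mem_nhdsWithin _ (Metric.closedBall_mem_nhds y hr), ?_⟩
    have := H (s ∩ Metric.closedBall y r) inter_subset_right
    rw [measure_mono_null inter_subset_left hs] at this
    simpa using this
  rw [← Measure.withDensity_rnDeriv_eq ρ volume hac]
  refine withDensity_congr_ae ?_
  -- Almost everywhere the density is the limit of the ratios of measures of small closed balls. The
  -- bounds `upper` and `lower` pin this limit between multiples of the determinant, and `ε → 0`
  -- closes the gap.
  filter_upwards [Besicovitch.ae_tendsto_rnDeriv ρ (volume : Measure U)] with y hy
  have hvol : ∀ r > 0, volume (Metric.closedBall y r) ≠ 0 := fun r hr =>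
    (Metric.measure_closedBall_pos volume y hr).ne'
  have hvol' : ∀ r, volume (Metric.closedBall y r) ≠ ∞ := fun r => measure_closedBall_lt_top.ne
  set L := ENNReal.ofReal |(S y).toLinearMap.det|
  apply le_antisymm
  · have hε : ∀ ε > (0 : ℝ), ρ.rnDeriv volume y ≤ ENNReal.ofReal (1 + ε) ^ d * L := by
      intro ε hε
      obtain ⟨r, hr, H⟩ := upper y ε hε
      refine le_of_tendsto hy ?_
      filter_upwards [Ioc_mem_nhdsGT hr] with t ht
      rw [ENNReal.div_le_iff (hvol t ht.1) (hvol' t), mul_assoc]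
      exact H _ (Metric.closedBall_subset_closedBall ht.2)
    have hlim : Tendsto (fun ε : ℝ => ENNReal.ofReal (1 + ε) ^ d * L) (𝓝[>] 0)
        (𝓝 (ENNReal.ofReal (1 + 0) ^ d * L)) := by
      refine ENNReal.Tendsto.mul_const ?_ (Or.inr ENNReal.ofReal_ne_top)
      refine ((ENNReal.continuous_pow d).tendsto _).comp ?_
      refine (ENNReal.continuous_ofReal.tendsto _).comp ?_
      exact ((continuous_const.add continuous_id).tendsto (0 : ℝ)).mono_left nhdsWithin_le_nhds
    have := ge_of_tendsto hlim (eventually_mem_nhdsWithin.mono fun ε he => hε ε he)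
    simpa using this
  · have hε : ∀ ε ∈ Ioo (0 : ℝ) 1, L ≤ ENNReal.ofReal ((1 - ε)⁻¹) ^ d * ρ.rnDeriv volume y := by
      intro ε hε
      obtain ⟨r, hr, H⟩ := lower y ε hε.1 hε.2
      have h0 : ENNReal.ofReal ((1 - ε)⁻¹) ^ d ≠ ∞ := by finiteness
      refine ge_of_tendsto (ENNReal.Tendsto.const_mul hy (Or.inr h0)) ?_
      filter_upwards [Ioc_mem_nhdsGT hr] with t ht
      rw [← mul_div_assoc, ENNReal.le_div_iff_mul_le (Or.inl (hvol t ht.1)) (Or.inl (hvol' t))]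
      exact H _ (Metric.closedBall_subset_closedBall ht.2)
    -- Multiplication by the density is continuous in the other factor only when the density is
    -- finite; for an infinite one the bound is trivial.
    by_cases htop : ρ.rnDeriv volume y = ∞
    · rw [htop]; exact le_top
    have hlim : Tendsto (fun ε : ℝ => ENNReal.ofReal ((1 - ε)⁻¹) ^ d * ρ.rnDeriv volume y) (𝓝[>] 0)
        (𝓝 (ENNReal.ofReal ((1 - 0)⁻¹) ^ d * ρ.rnDeriv volume y)) := by
      refine ENNReal.Tendsto.mul_const ?_ (Or.inr htop)
      refine ((ENNReal.continuous_pow d).tendsto _).comp ?_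
      refine (ENNReal.continuous_ofReal.tendsto _).comp ?_
      have : ContinuousAt (fun ε : ℝ => (1 - ε)⁻¹) 0 :=
        (continuousAt_const.sub continuousAt_id).inv₀ (by norm_num)
      exact this.tendsto.mono_left nhdsWithin_le_nhds
    have := ge_of_tendsto hlim (by
      filter_upwards [Ioo_mem_nhdsGT (one_pos : (0 : ℝ) < 1)] with ε he using hε ε he)
    simpa using this

end AreaFormula

/-! ### Geometry and surface measure of a graph over a hyperplane. -/

section Graph

variable {E : Type*} [NormedAddCommGroup E] [InnerProductSpace ℝ E]

/-- The parametrization of the graph of `g` in the direction `e`. -/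
def graphMap (e : E) (g : (ℝ ∙ e)ᗮ → ℝ) (y : (ℝ ∙ e)ᗮ) : E := (y : E) + g y • e

/-- The height above the graph of `g` in the direction `e`. -/
noncomputable def graphHeight (e : E) (g : (ℝ ∙ e)ᗮ → ℝ) (x : E) : ℝ :=
  ⟪e, x⟫_ℝ - g ((ℝ ∙ e)ᗮ.orthogonalProjectionOnto x)

variable {e : E} {g : (ℝ ∙ e)ᗮ → ℝ}

theorem orthogonalProjectionOnto_add_smul_self (y : (ℝ ∙ e)ᗮ) (t : ℝ) :
    (ℝ ∙ e)ᗮ.orthogonalProjectionOnto ((y : E) + t • e) = y := by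
  have h : (ℝ ∙ e)ᗮ.orthogonalProjectionOnto e = 0 := by
    rw [Submodule.orthogonalProjectionOnto_eq_zero_iff]
    exact Submodule.le_orthogonal_orthogonal _ (Submodule.mem_span_singleton_self e)
  rw [map_add, map_smul, h, smul_zero, add_zero,
    Submodule.orthogonalProjectionOnto_mem_subspace_eq_self]

theorem inner_add_smul_self (he : ‖e‖ = 1) (y : (ℝ ∙ e)ᗮ) (t : ℝ) :
    ⟪e, (y : E) + t • e⟫_ℝ = t := by
  rw [inner_add_right, inner_smul_right, real_inner_self_eq_norm_sq, he,
    Submodule.mem_orthogonal_singleton_iff_inner_right.1 y.2]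
  ring

theorem orthogonalProjectionOnto_add_inner_smul (he : ‖e‖ = 1) (x : E) :
    ((ℝ ∙ e)ᗮ.orthogonalProjectionOnto x : E) + ⟪e, x⟫_ℝ • e = x := by
  have h := Submodule.starProjection_add_starProjection_orthogonal (K := ℝ ∙ e) x
  rw [Submodule.starProjection_unit_singleton ℝ he] at h
  rw [add_comm]
  exact h

theorem orthogonalProjectionOnto_graphMap (y : (ℝ ∙ e)ᗮ) :
    (ℝ ∙ e)ᗮ.orthogonalProjectionOnto (graphMap e g y) = y :=
  orthogonalProjectionOnto_add_smul_self y _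

theorem graphHeight_add_smul (he : ‖e‖ = 1) (y : (ℝ ∙ e)ᗮ) (t : ℝ) :
    graphHeight e g (graphMap e g y + t • e) = t := by
  rw [graphHeight, graphMap, add_assoc, ← add_smul, inner_add_smul_self he,
    orthogonalProjectionOnto_add_smul_self]
  ring

theorem graphHeight_graphMap (he : ‖e‖ = 1) (y : (ℝ ∙ e)ᗮ) :
    graphHeight e g (graphMap e g y) = 0 := by
  simpa using graphHeight_add_smul (g := g) he y 0

theorem range_graphMap (he : ‖e‖ = 1) : range (graphMap e g) = {x | graphHeight e g x = 0} := by
  ext x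
  constructor
  · rintro ⟨y, rfl⟩
    exact graphHeight_graphMap he y
  · intro hx
    refine ⟨(ℝ ∙ e)ᗮ.orthogonalProjectionOnto x, ?_⟩
    rw [graphMap, ← sub_eq_zero.1 hx, orthogonalProjectionOnto_add_inner_smul he]

theorem continuous_graphMap (hg : Continuous g) : Continuous (graphMap e g) := by
  unfold graphMap; fun_prop

theorem contDiff_graphMap {n : WithTop ℕ∞} (hg : ContDiff ℝ n g) :
    ContDiff ℝ n (graphMap e g) :=
  (ℝ ∙ e)ᗮ.subtypeL.contDiff.add (hg.smul contDiff_const)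

theorem contDiff_graphHeight {n : WithTop ℕ∞} (hg : ContDiff ℝ n g) :
    ContDiff ℝ n (graphHeight e g) :=
  (contDiff_const.inner ℝ contDiff_id).sub
    (hg.comp (ℝ ∙ e)ᗮ.orthogonalProjectionOnto.contDiff)

theorem isClosedEmbedding_graphMap (hg : Continuous g) :
    IsClosedEmbedding (graphMap e g) :=
  Function.LeftInverse.isClosedEmbedding (f := (ℝ ∙ e)ᗮ.orthogonalProjectionOnto)
    orthogonalProjectionOnto_graphMap (ContinuousLinearMap.continuous _) (continuous_graphMap hg)

theorem norm_coe_add_smul_sq (he : ‖e‖ = 1) (w : (ℝ ∙ e)ᗮ) (t : ℝ) :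
    ‖(w : E) + t • e‖ ^ 2 = ‖w‖ ^ 2 + t ^ 2 := by
  rw [norm_add_sq_real, inner_smul_right,
    Submodule.mem_orthogonal_singleton_iff_inner_left.1 w.2, norm_smul, he]
  simp

/-- A linear endomorphism `S` with `‖S w‖² = ‖w‖² + ⟪a, w⟫²`. -/
noncomputable def stretchMap {U : Type*} [NormedAddCommGroup U] [InnerProductSpace ℝ U] (a : U) :
    U →L[ℝ] U :=
  -- With `s = √(1 + ‖a‖²)`, this map stretches by `s` along `a` and is the identity on the
  -- complement of `a`. The coefficient `(1 + s)⁻¹` equals `(s - 1)/‖a‖²` in a form that also covers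
  -- `a = 0`.
  ContinuousLinearMap.id ℝ U +
    (innerSL ℝ a).smulRight ((1 + √(1 + ‖a‖ ^ 2))⁻¹ • a)

theorem norm_stretchMap_sq {U : Type*} [NormedAddCommGroup U] [InnerProductSpace ℝ U] (a w : U) :
    ‖stretchMap a w‖ ^ 2 = ‖w‖ ^ 2 + ⟪a, w⟫_ℝ ^ 2 := by
  have hs : √(1 + ‖a‖ ^ 2) ^ 2 = 1 + ‖a‖ ^ 2 := Real.sq_sqrt (by positivity)
  have hp : 0 < 1 + √(1 + ‖a‖ ^ 2) := by positivity
  simp only [stretchMap, add_apply, ContinuousLinearMap.id_apply,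
    ContinuousLinearMap.smulRight_apply, innerSL_apply_apply]
  rw [norm_add_sq_real, inner_smul_right, inner_smul_right, real_inner_comm a w, smul_smul,
    norm_smul, mul_pow, Real.norm_eq_abs, sq_abs]
  have ha : ‖a‖ ^ 2 = √(1 + ‖a‖ ^ 2) ^ 2 - 1 := by linarith
  generalize √(1 + ‖a‖ ^ 2) = s at *
  rw [ha]
  field_simp
  ring

/-- A rank-one perturbation of the identity has determinant `1` plus the form evaluated at the
vector, here `1 + ‖a‖²/(1 + s) = s` with `s² = 1 + ‖a‖²`. -/
theorem det_stretchMap {U : Type*} [NormedAddCommGroup U] [InnerProductSpace ℝ U]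
    [FiniteDimensional ℝ U] (a : U) :
    (stretchMap a).toLinearMap.det = √(1 + ‖a‖ ^ 2) := by
  have hs : √(1 + ‖a‖ ^ 2) ^ 2 = 1 + ‖a‖ ^ 2 := Real.sq_sqrt (by positivity)
  have hp : 0 < 1 + √(1 + ‖a‖ ^ 2) := by positivity
  have : (stretchMap a).toLinearMap
      = LinearMap.transvection (innerSL ℝ a).toLinearMap ((1 + √(1 + ‖a‖ ^ 2))⁻¹ • a) := by
    ext w; simp [stretchMap, LinearMap.transvection.apply]
  rw [this, LinearMap.transvection.det]
  simp only [ContinuousLinearMap.coe_coe, innerSL_apply_apply, inner_smul_right,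
    real_inner_self_eq_norm_sq]
  have ha : ‖a‖ ^ 2 = √(1 + ‖a‖ ^ 2) ^ 2 - 1 := by linarith
  generalize √(1 + ‖a‖ ^ 2) = s at *
  rw [ha]
  field_simp
  ring

variable [FiniteDimensional ℝ E]

theorem hasGradientAt_graphHeight (hg : ContDiff ℝ 1 g) (x : E) :
    HasGradientAt (graphHeight e g)
      (e - ((gradient g ((ℝ ∙ e)ᗮ.orthogonalProjectionOnto x) : (ℝ ∙ e)ᗮ) : E)) x := by
  have h1 := (hg.differentiable one_ne_zero
    ((ℝ ∙ e)ᗮ.orthogonalProjectionOnto x)).hasGradientAt.hasFDerivAt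
  have h2 := ((innerSL ℝ e).hasFDerivAt (x := x)).sub
    (h1.comp x (ℝ ∙ e)ᗮ.orthogonalProjectionOnto.hasFDerivAt)
  rw [hasGradientAt_iff_hasFDerivAt]
  convert! h2 using 1
  ext v
  have := Submodule.inner_orthogonalProjectionOnto_eq_of_mem_left
    (gradient g ((ℝ ∙ e)ᗮ.orthogonalProjectionOnto x)) v
  rw [InnerProductSpace.toDual_apply_apply, inner_sub_left, ← this]
  rfl

theorem gradient_graphHeight (hg : ContDiff ℝ 1 g) (x : E) :
    gradient (graphHeight e g) x
      = e - ((gradient g ((ℝ ∙ e)ᗮ.orthogonalProjectionOnto x) : (ℝ ∙ e)ᗮ) : E) :=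
  (hasGradientAt_graphHeight hg x).gradient

theorem norm_gradient_graphHeight_sq (he : ‖e‖ = 1) (hg : ContDiff ℝ 1 g) (x : E) :
    ‖gradient (graphHeight e g) x‖ ^ 2
      = 1 + ‖gradient g ((ℝ ∙ e)ᗮ.orthogonalProjectionOnto x)‖ ^ 2 := by
  have := norm_coe_add_smul_sq he (-gradient g ((ℝ ∙ e)ᗮ.orthogonalProjectionOnto x)) 1
  rw [gradient_graphHeight hg]
  rw [norm_neg] at this
  rw [sub_eq_neg_add, ← Submodule.coe_neg]
  rw [one_smul] at this
  linarith

theorem one_le_norm_gradient_graphHeight (he : ‖e‖ = 1) (hg : ContDiff ℝ 1 g) (x : E) :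
    1 ≤ ‖gradient (graphHeight e g) x‖ := by
  rw [← one_le_sq_iff₀ (norm_nonneg _), norm_gradient_graphHeight_sq he hg]
  linarith [sq_nonneg ‖gradient g ((ℝ ∙ e)ᗮ.orthogonalProjectionOnto x)‖]

variable [MeasurableSpace E] [BorelSpace E]

/-- The surface measure of a graph. -/
theorem restrict_range_graphMap (he : ‖e‖ = 1) (hg : ContDiff ℝ 1 g) :
    (μHE[Module.finrank ℝ (ℝ ∙ e)ᗮ] : Measure E).restrict (range (graphMap e g))
      = (volume.withDensity
          (fun y => ENNReal.ofReal √(1 + ‖gradient g y‖ ^ 2))).map (graphMap e g) := by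
  have hemb := (isClosedEmbedding_graphMap hg.continuous).measurableEmbedding
  -- The derivative of `graphMap` at `y` sends `w` to `w + ⟪∇g, w⟫ e`. The map `stretchMap (gradient
  -- g y)` gives `w` the same length while staying inside the hyperplane, where a determinant is
  -- available.
  rw [← hemb.map_comap,
    comap_euclideanHausdorffMeasure_eq_withDensity hemb (fun y => stretchMap (gradient g y))]
  · simp only [det_stretchMap, abs_of_nonneg (Real.sqrt_nonneg _)]
  · intro y
    rw [det_stretchMap]
    positivity
  · intro y ε hε
    -- Strict differentiability is used because both `p` and `q` vary near `y`.
    have hd : HasStrictFDerivAt g (innerSL ℝ (gradient g y)) y := by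
      have h1 := hg.contDiffAt.hasStrictFDerivAt (x := y) one_ne_zero
      have h2 := (hg.differentiable one_ne_zero y).hasGradientAt.hasFDerivAt
      rw [h2.fderiv] at h1
      exact h1
    have hlo := hd.isLittleO.def hε
    rw [nhds_prod_eq, (Metric.nhds_basis_closedBall.prod_self).eventually_iff] at hlo
    obtain ⟨r, hr, H⟩ := hlo
    refine ⟨r, hr, fun p hp q hq => ?_⟩
    have H := H (mk_mem_prod hp hq)
    simp only at H
    set a := gradient g y
    have hS : ‖stretchMap a (p - q)‖ = ‖((p - q : (ℝ ∙ e)ᗮ) : E) + ⟪a, p - q⟫_ℝ • e‖ := by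
      rw [← sq_eq_sq₀ (norm_nonneg _) (norm_nonneg _), norm_stretchMap_sq,
        norm_coe_add_smul_sq he]
    have hle : ‖p - q‖ ≤ ‖stretchMap a (p - q)‖ := by
      rw [← sq_le_sq₀ (norm_nonneg _) (norm_nonneg _), norm_stretchMap_sq]
      nlinarith [sq_nonneg ⟪a, p - q⟫_ℝ]
    calc |dist (graphMap e g p) (graphMap e g q) - ‖stretchMap a (p - q)‖|
        ≤ ‖(graphMap e g p - graphMap e g q)
            - (((p - q : (ℝ ∙ e)ᗮ) : E) + ⟪a, p - q⟫_ℝ • e)‖ := by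
          rw [hS, dist_eq_norm]; exact abs_norm_sub_norm_le _ _
      _ = ‖(g p - g q - ⟪a, p - q⟫_ℝ) • e‖ := by
          congr 1
          simp only [graphMap, AddSubgroupClass.coe_sub]
          module
      _ ≤ ε * ‖p - q‖ := by rw [norm_smul, he, mul_one]; exact H
      _ ≤ ε * ‖stretchMap a (p - q)‖ := by gcongr

/-- The area density `√(1 + |∇g|²)` is the length of the gradient of the height function. In this
form it combines with `∇G = |∇G| n` when fluxes through the graph are computed. -/
theorem setIntegral_range_graphMap (he : ‖e‖ = 1) (hg : ContDiff ℝ 1 g) (h : E → ℝ) :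
    ∫ x in range (graphMap e g), h x ∂(μHE[Module.finrank ℝ (ℝ ∙ e)ᗮ])
      = ∫ y, ‖gradient (graphHeight e g) (graphMap e g y)‖ * h (graphMap e g y) := by
  have hemb := (isClosedEmbedding_graphMap (e := e) hg.continuous).measurableEmbedding
  have hcg : Continuous (gradient g) :=
    (InnerProductSpace.toDual ℝ (ℝ ∙ e)ᗮ).symm.continuous.comp (hg.continuous_fderiv one_ne_zero)
  rw [restrict_range_graphMap he hg, hemb.integral_map,
    integral_withDensity_eq_integral_toReal_smul (by fun_prop) (by simp)]
  refine integral_congr_ae (Eventually.of_forall fun y => ?_)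
  have h2 := norm_gradient_graphHeight_sq he hg (graphMap e g y)
  rw [orthogonalProjectionOnto_graphMap] at h2
  simp only [smul_eq_mul, ENNReal.toReal_ofReal (Real.sqrt_nonneg _)]
  rw [← h2, Real.sqrt_sq (norm_nonneg _)]

/-- Compact pieces of a graph have finite surface measure. -/
theorem measure_range_graphMap_inter_lt_top (he : ‖e‖ = 1) (hg : ContDiff ℝ 1 g) {K : Set E}
    (hK : IsCompact K) :
    (μHE[Module.finrank ℝ (ℝ ∙ e)ᗮ] : Measure E) (range (graphMap e g) ∩ K) < ∞ := by
  have hemb := isClosedEmbedding_graphMap (e := e) hg.continuous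
  have hcg : Continuous (gradient g) :=
    (InnerProductSpace.toDual ℝ (ℝ ∙ e)ᗮ).symm.continuous.comp (hg.continuous_fderiv one_ne_zero)
  rw [inter_comm, ← Measure.restrict_apply hK.measurableSet, restrict_range_graphMap he hg,
    hemb.measurableEmbedding.map_apply]
  have : IsLocallyFiniteMeasure ((volume : Measure (ℝ ∙ e)ᗮ).withDensity
      (fun y => ENNReal.ofReal √(1 + ‖gradient g y‖ ^ 2))) :=
    IsLocallyFiniteMeasure.withDensity_ofReal (by fun_prop)
  exact (hemb.isCompact_preimage hK).measure_lt_top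

end Graph

/-! ### Traces, gradients and the divergence of compactly supported fields. -/

section Divergence

variable {E : Type*} [NormedAddCommGroup E] [InnerProductSpace ℝ E] [FiniteDimensional ℝ E]

variable (E) in
/-- The trace as a continuous linear form on endomorphisms. -/
noncomputable def traceL : (E →L[ℝ] E) →L[ℝ] ℝ :=
  LinearMap.toContinuousLinearMap
    ((LinearMap.trace ℝ E).comp (ContinuousLinearMap.coeLM ℝ))

theorem traceL_apply (A : E →L[ℝ] E) : traceL E A = LinearMap.trace ℝ E A.toLinearMap := rfl

variable (E) in
/-- The Riesz isomorphism, from linear forms to vectors, as a continuous linear map. -/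
noncomputable def rieszL : (E →L[ℝ] ℝ) →L[ℝ] E :=
  LinearMap.toContinuousLinearMap
    { toFun := (InnerProductSpace.toDual ℝ E).symm
      map_add' := map_add _
      map_smul' := by simp }

theorem rieszL_apply (l : E →L[ℝ] ℝ) : rieszL E l = (InnerProductSpace.toDual ℝ E).symm l := rfl

theorem inner_rieszL (l : E →L[ℝ] ℝ) (v : E) : ⟪rieszL E l, v⟫_ℝ = l v := by
  rw [rieszL_apply, InnerProductSpace.toDual_symm_apply]

theorem gradient_eq_rieszL (f : E → ℝ) (x : E) : gradient f x = rieszL E (fderiv ℝ f x) := rfl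

theorem gradientWithin_eq_rieszL (f : E → ℝ) (s : Set E) (x : E) :
    gradientWithin f s x = rieszL E (fderivWithin ℝ f s x) := rfl

theorem inner_gradient_left' (f : E → ℝ) (x v : E) : ⟪gradient f x, v⟫_ℝ = fderiv ℝ f x v :=
  inner_rieszL _ _

theorem inner_gradientWithin_left' (f : E → ℝ) (s : Set E) (x v : E) :
    ⟪gradientWithin f s x, v⟫_ℝ = fderivWithin ℝ f s x v :=
  inner_rieszL _ _

theorem traceL_smulRight (l : E →L[ℝ] ℝ) (v : E) : traceL E (l.smulRight v) = l v := by
  rw [traceL_apply]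
  exact LinearMap.trace_smulRight l.toLinearMap v

theorem traceL_eq_sum_inner {ι : Type*} [Fintype ι] (b : OrthonormalBasis ι ℝ E)
    (A : E →L[ℝ] E) : traceL E A = ∑ i, ⟪b i, A (b i)⟫_ℝ :=
  LinearMap.trace_eq_sum_inner A.toLinearMap b

theorem ContDiff.gradient {n : WithTop ℕ∞} {f : E → ℝ} (hf : ContDiff ℝ (n + 1) f) :
    ContDiff ℝ n (gradient f) :=
  (rieszL E).contDiff.comp (hf.fderiv_right le_rfl)

/-- The divergence of a vector field. -/
noncomputable def divergence (F : E → E) (x : E) : ℝ := traceL E (fderiv ℝ F x)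

theorem divergence_smul {φ : E → ℝ} {F : E → E} {x : E} (hφ : DifferentiableAt ℝ φ x)
    (hF : DifferentiableAt ℝ F x) :
    divergence (fun y => φ y • F y) x = φ x * divergence F x + fderiv ℝ φ x (F x) := by
  rw [divergence, fderiv_fun_smul hφ hF, map_add, map_smul, traceL_smulRight]
  rfl

theorem laplacian_eq_divergence_gradient {f : E → ℝ} {x : E} (hf : ContDiffAt ℝ 2 f x) :
    Laplacian.laplacian f x = divergence (gradient f) x := by
  have hd : DifferentiableAt ℝ (fderiv ℝ f) x :=
    (hf.fderiv_right (m := 1) (by norm_num)).differentiableAt one_ne_zero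
  have h : fderiv ℝ (gradient f) x = (rieszL E).comp (fderiv ℝ (fderiv ℝ f) x) :=
    ((rieszL E).hasFDerivAt.comp x hd.hasFDerivAt).fderiv
  rw [InnerProductSpace.laplacian_eq_iteratedFDeriv_stdOrthonormalBasis, divergence,
    traceL_eq_sum_inner (stdOrthonormalBasis ℝ E), h]
  refine Finset.sum_congr rfl fun i _ => ?_
  rw [iteratedFDeriv_two_apply, real_inner_comm, ContinuousLinearMap.comp_apply, inner_rieszL]
  rfl

variable [MeasurableSpace E] [BorelSpace E]

/-- The divergence of a compactly supported field has zero integral. -/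
theorem integral_divergence_eq_zero {F : E → E} (hF : ContDiff ℝ 1 F)
    (hc : HasCompactSupport F) : ∫ x, divergence F x = 0 := by
  have hcf : Continuous (fderiv ℝ F) := hF.continuous_fderiv one_ne_zero
  have hd : Differentiable ℝ F := hF.differentiable one_ne_zero
  set b := stdOrthonormalBasis ℝ E
  have hfd : ∀ i x, fderiv ℝ (fun y => ⟪b i, F y⟫_ℝ) x (b i) = ⟪b i, fderiv ℝ F x (b i)⟫_ℝ := by
    intro i x
    exact congrArg (fun l => l (b i))
      ((innerSL ℝ (b i)).hasFDerivAt.comp x (hd x).hasFDerivAt).fderiv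
  have hint : ∀ i, Integrable (fun x => ⟪b i, fderiv ℝ F x (b i)⟫_ℝ) := by
    intro i
    refine Continuous.integrable_of_hasCompactSupport (by fun_prop) ?_
    refine (hc.fderiv (𝕜 := ℝ)).mono fun x hx => ?_
    contrapose! hx
    simp [Function.notMem_support.1 hx]
  have hint0 : ∀ i, Integrable (fun x => ⟪b i, F x⟫_ℝ) := by
    intro i
    refine Continuous.integrable_of_hasCompactSupport
      (continuous_const.inner hF.continuous) ?_
    refine hc.mono fun x hx => ?_
    contrapose! hx
    simp [Function.notMem_support.1 hx]
  simp only [divergence, traceL_eq_sum_inner b]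
  rw [integral_finsetSum _ fun i _ => hint i]
  refine Finset.sum_eq_zero fun i _ => ?_
  -- Integration by parts against the constant `1`: only the products have to be integrable, and one
  -- side vanishes.
  have key := integral_mul_fderiv_eq_neg_fderiv_mul_of_integrable (μ := (volume : Measure E))
    (f := fun _ => (1 : ℝ)) (g := fun y => ⟪b i, F y⟫_ℝ) (v := b i) (by simp)
    (by simpa [hfd] using hint i) (by simpa using hint0 i)
    (fun x _ => differentiableAt_const _)
    (fun x _ => (differentiableAt_const _).inner ℝ (hd x))
  simpa [hfd] using key

end Divergence

/-! ### Interior smoothness of functions with constant Laplacian. -/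

section Regularity

variable {E : Type*} [NormedAddCommGroup E] [InnerProductSpace ℝ E] [FiniteDimensional ℝ E]
  [MeasurableSpace E] [BorelSpace E]

/-- A radial mollifier `φ` together with a potential `ψ` of the field `z ↦ φ z • z`. -/
theorem exists_radial_mollifier (r : ℝ) (hr : 0 < r) :
    ∃ φ ψ : E → ℝ, ContDiff ℝ (⊤ : ℕ∞) φ ∧ ContDiff ℝ 1 ψ ∧ 0 < ∫ z, φ z ∧
      (∀ z, r ≤ ‖z‖ → φ z = 0) ∧ (∀ z, r ≤ ‖z‖ → ψ z = 0) ∧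
      ∀ z v, fderiv ℝ ψ z v = φ z * ⟪z, v⟫_ℝ := by
  set η : ℝ → ℝ := fun s => Real.smoothTransition (r ^ 2 - s) with hη
  have hηs : ContDiff ℝ (⊤ : ℕ∞) η := Real.smoothTransition.contDiff.comp
    (contDiff_const.sub contDiff_id)
  have hη0 : ∀ s, r ^ 2 ≤ s → η s = 0 := fun s hs =>
    Real.smoothTransition.zero_of_nonpos (by linarith)
  -- The primitive is based at `r²`, beyond which `η` vanishes, so that `ψ = H(‖z‖²)/2` is also
  -- supported in the ball of radius `r`. The factor `1/2` cancels the one coming from the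
  -- derivative of `‖z‖²`.
  set H : ℝ → ℝ := fun s => ∫ t in (r ^ 2)..s, η t with hH
  have hHd : ∀ s, HasDerivAt H (η s) s := fun s =>
    intervalIntegral.integral_hasDerivAt_right (hηs.continuous.intervalIntegrable _ _)
      (hηs.continuous.stronglyMeasurableAtFilter _ _) hηs.continuous.continuousAt
  have hH0 : ∀ s, r ^ 2 ≤ s → H s = 0 := by
    intro s hs
    simp only [hH]
    rw [intervalIntegral.integral_congr (g := fun _ => 0), intervalIntegral.integral_zero]
    intro t ht
    rw [uIcc_of_le hs] at ht
    exact hη0 t ht.1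
  have hHs : ContDiff ℝ 1 H := by
    rw [contDiff_one_iff_deriv]
    refine ⟨fun s => (hHd s).differentiableAt, ?_⟩
    rw [funext fun s => (hHd s).deriv]
    exact hηs.continuous
  have hsq : ∀ z : E, r ≤ ‖z‖ → r ^ 2 ≤ ‖z‖ ^ 2 := fun z hz => by gcongr
  have hφs : ContDiff ℝ (⊤ : ℕ∞) fun z : E => η (‖z‖ ^ 2) := hηs.comp (contDiff_norm_sq ℝ)
  refine ⟨fun z => η (‖z‖ ^ 2), fun z => 2⁻¹ * H (‖z‖ ^ 2), hφs,
    contDiff_const.mul (hHs.comp (contDiff_norm_sq ℝ)), ?_, fun z hz => hη0 _ (hsq z hz),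
    fun z hz => by simp only [hH0 _ (hsq z hz), mul_zero], fun z v => ?_⟩
  · refine hφs.continuous.integral_pos_of_hasCompactSupport_nonneg_nonzero (x := 0) ?_
      (fun z => Real.smoothTransition.nonneg _) ?_
    · refine HasCompactSupport.of_support_subset_isCompact (isCompact_closedBall (0 : E) r) ?_
      intro z hz
      rw [mem_closedBall_zero_iff]
      by_contra hlt
      exact hz (hη0 _ (hsq z (not_le.1 hlt).le))
    · exact (Real.smoothTransition.pos_of_pos (by simp; positivity)).ne'
  · have h1 : HasFDerivAt (fun z : E => ‖z‖ ^ 2) (2 • innerSL ℝ z) z :=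
      (hasStrictFDerivAt_norm_sq z).hasFDerivAt
    have h2 := ((hHd (‖z‖ ^ 2)).comp_hasFDerivAt z h1).const_mul 2⁻¹
    have h3 := h2.fderiv
    simp only [Function.comp_def] at h3
    rw [h3]
    simp
    ring

/-- Consider `t ↦ ∫ φ(z) f(x - tz) dz` on `[0, 1]`. Its derivative is `-∫ ⟨∇ψ(z), ∇f(x - tz)⟩ dz`,
which after integration by parts is `-t ∫ ψ(z) Δf(x - tz) dz = -tc ∫ ψ`. Integrating in `t` compares
`f(x) ∫ φ` with the mollification, up to a constant independent of `x`. -/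
theorem mollify_eq_of_laplacian_eq_const {f : E → ℝ} (hf : ContDiff ℝ 2 f)
    (hfc : HasCompactSupport f) {c r : ℝ} {x : E}
    (hΔ : ∀ y ∈ Metric.ball x r, Laplacian.laplacian f y = c)
    {φ ψ : E → ℝ} (hφ : ContDiff ℝ (⊤ : ℕ∞) φ) (hψ : ContDiff ℝ 1 ψ)
    (hφ0 : ∀ z, r ≤ ‖z‖ → φ z = 0) (hψ0 : ∀ z, r ≤ ‖z‖ → ψ z = 0)
    (hφψ : ∀ z v, fderiv ℝ ψ z v = φ z * ⟪z, v⟫_ℝ) :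
    f x * ∫ z, φ z = (∫ z, φ z * f (x - z)) + c / 2 * ∫ z, ψ z := by
  have hcs : ∀ {χ : E → ℝ}, (∀ z, r ≤ ‖z‖ → χ z = 0) → HasCompactSupport χ := by
    intro χ hχ
    refine HasCompactSupport.of_support_subset_isCompact (isCompact_closedBall (0 : E) r) ?_
    intro z hz
    rw [mem_closedBall_zero_iff]
    by_contra hlt
    exact hz (hχ z (not_le.1 hlt).le)
  have hf1 : ContDiff ℝ 1 f := hf.of_le (by norm_num)
  have hfd : Differentiable ℝ f := hf1.differentiable one_ne_zero
  have hDf : Continuous (fderiv ℝ f) := hf1.continuous_fderiv one_ne_zero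
  obtain ⟨C, hC⟩ := (hfc.fderiv (𝕜 := ℝ)).exists_bound_of_continuous hDf
  have hG : ContDiff ℝ 1 (gradient f) := ContDiff.gradient (by simpa [one_add_one_eq_two] using hf)
  have hGd : Differentiable ℝ (gradient f) := hG.differentiable one_ne_zero
  have hφc := hφ.continuous
  have hder : ∀ t ∈ Icc (0 : ℝ) 1,
      HasDerivAt (fun t : ℝ => ∫ z, φ z * f (x - t • z)) (t * (-c * ∫ z, ψ z)) t := by
    intro t ht
    have h1 := (hasDerivAt_integral_of_dominated_loc_of_deriv_le (μ := (volume : Measure E))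
      (F := fun (t : ℝ) z => φ z * f (x - t • z))
      (F' := fun (t : ℝ) z => φ z * fderiv ℝ f (x - t • z) (-z))
      (bound := fun z => |φ z| * (C * ‖z‖)) (x₀ := t) univ_mem
      (Eventually.of_forall fun s => by
        have := hf.continuous
        exact (by fun_prop : Continuous fun z => φ z * f (x - s • z)).aestronglyMeasurable)
      (by
        have := hf.continuous
        exact (by fun_prop : Continuous fun z => φ z * f (x - t • z)).integrable_of_hasCompactSupport
          (hcs hφ0).mul_right)
      (by fun_prop : Continuous fun z => φ z * fderiv ℝ f (x - t • z) (-z)).aestronglyMeasurable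
      (Eventually.of_forall fun z s _ => by
        rw [norm_mul, Real.norm_eq_abs]
        gcongr
        refine (ContinuousLinearMap.le_opNorm _ _).trans ?_
        rw [norm_neg]
        gcongr
        exact hC _)
      ((by fun_prop : Continuous fun z => |φ z| * (C * ‖z‖)).integrable_of_hasCompactSupport
        (hcs (χ := fun z => |φ z|) (fun z hz => by simp [hφ0 z hz])).mul_right)
      (Eventually.of_forall fun z s _ => by
        have h2 : HasDerivAt (fun s : ℝ => x - s • z) (-z) s := by
          simpa using ((hasDerivAt_id s).smul_const z).const_sub x
        exact ((hfd _).hasFDerivAt.comp_hasDerivAt s h2).const_mul _)).2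
    convert! h1 using 1
    have hψd : Differentiable ℝ ψ := hψ.differentiable one_ne_zero
    have hGt : ∀ z, HasFDerivAt (fun z => gradient f (x - t • z))
        (-t • fderiv ℝ (gradient f) (x - t • z)) z := by
      intro z
      have h2 : HasFDerivAt (fun z : E => x - t • z) (-(t • ContinuousLinearMap.id ℝ E)) z :=
        ((hasFDerivAt_id z).const_smul t).const_sub x
      convert! (hGd _).hasFDerivAt.comp z h2 using 1
      ext v
      simp
    have hdiv : ∀ z, divergence (fun z => ψ z • gradient f (x - t • z)) z
        = -(t * (c * ψ z)) - φ z * fderiv ℝ f (x - t • z) (-z) := by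
      intro z
      rw [divergence_smul (hψd z) (hGt z).differentiableAt, hφψ, real_inner_comm,
        inner_gradient_left', divergence, (hGt z).fderiv, map_smul, map_neg]
      by_cases hz : r ≤ ‖z‖
      · simp [hψ0 z hz]
      -- For `t ≤ 1` the point `x - tz` stays in the ball where the Laplacian is known.
      · have hmem : x - t • z ∈ Metric.ball x r := by
          rw [mem_ball_iff_norm, sub_sub_cancel_left, norm_neg, norm_smul, Real.norm_eq_abs,
            abs_of_nonneg ht.1]
          nlinarith [norm_nonneg z, ht.2]
        have := hΔ _ hmem
        rw [laplacian_eq_divergence_gradient hf.contDiffAt, divergence] at this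
        rw [this, smul_eq_mul]
        ring
    have hzero := integral_divergence_eq_zero (F := fun z => ψ z • gradient f (x - t • z))
      (hψ.smul (hG.comp (contDiff_const.sub (contDiff_const.smul contDiff_id))))
      (hcs hψ0).smul_right
    simp only [hdiv] at hzero
    rw [integral_sub] at hzero
    · rw [← sub_eq_zero.1 hzero, integral_neg, integral_const_mul, integral_const_mul]
      ring
    · have := hψ.continuous
      exact ((by fun_prop : Continuous fun z => -(t * (c * ψ z))).integrable_of_hasCompactSupport
        (hcs fun z hz => by simp [hψ0 z hz]))
    · exact (by fun_prop : Continuous fun z =>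
        φ z * fderiv ℝ f (x - t • z) (-z)).integrable_of_hasCompactSupport (hcs hφ0).mul_right
  have hftc := intervalIntegral.integral_eq_sub_of_hasDerivAt (a := 0) (b := 1)
    (fun t ht => hder t (by rwa [uIcc_of_le zero_le_one] at ht))
    ((by fun_prop : Continuous fun t : ℝ => t * (-c * ∫ z, ψ z)).intervalIntegrable _ _)
  rw [intervalIntegral.integral_mul_const, integral_id] at hftc
  simp only [one_smul, zero_smul, sub_zero, integral_mul_const] at hftc
  linarith

/-- A `C²` function with constant Laplacian on an open set is smooth there. -/
theorem contDiffOn_of_laplacian_eq_const {u : E → ℝ} {Ω : Set E} (hΩ : IsOpen Ω)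
    (hu : ContDiffOn ℝ 2 u Ω) {c : ℝ} (hΔ : ∀ x ∈ Ω, Laplacian.laplacian u x = c) :
    ContDiffOn ℝ (⊤ : ℕ∞) u Ω := by
  intro x₀ hx₀
  obtain ⟨R, hR, hRΩ⟩ := Metric.isOpen_iff.1 hΩ x₀ hx₀
  set χ : ContDiffBump x₀ := ⟨R / 2, R * (3 / 4), by positivity, by linarith⟩
  set f : E → ℝ := fun x => χ x * u x with hf
  have hsupp : tsupport χ ⊆ Ω := by
    rw [χ.tsupport_eq]
    exact (Metric.closedBall_subset_ball (show R * (3 / 4) < R by linarith)).trans hRΩ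
  have hfs : ContDiff ℝ 2 f := by
    rw [contDiff_iff_contDiffAt]
    intro x
    by_cases hx : x ∈ tsupport χ
    · exact χ.contDiff.contDiffAt.mul (hu.contDiffAt (hΩ.mem_nhds (hsupp hx)))
    · have : f =ᶠ[𝓝 x] fun _ => 0 := by
        filter_upwards [(isClosed_tsupport χ).isOpen_compl.mem_nhds hx] with y hy
        simp [hf, image_eq_zero_of_notMem_tsupport hy]
      exact contDiffAt_const.congr_of_eventuallyEq this
  have hfc : HasCompactSupport f := χ.hasCompactSupport.mul_right
  have hfu : EqOn f u (Metric.closedBall x₀ (R / 2)) := by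
    intro x hx
    simp [hf, χ.one_of_mem_closedBall hx]
  have hfΔ : ∀ x ∈ Metric.ball x₀ (R / 2), Laplacian.laplacian f x = c := by
    intro x hx
    have hev : f =ᶠ[𝓝 x] u := by
      filter_upwards [Metric.isOpen_ball.mem_nhds hx] with y hy
        using hfu (Metric.ball_subset_closedBall hy)
    rw [(InnerProductSpace.laplacian_congr_nhds hev).eq_of_nhds]
    exact hΔ x (hRΩ (Metric.ball_subset_ball (by linarith) hx))
  obtain ⟨φ, ψ, hφ, hψ, hpos, hφ0, hψ0, hφψ⟩ :=
    -- For `x` within `R/4` of `x₀`, a mollifier of radius `R/4` sees only the ball of radius `R/2`,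
    -- where the bump equals `1` and `f` coincides with `u`.
    exists_radial_mollifier (E := E) (R / 4) (by positivity)
  have hφc : HasCompactSupport φ := by
    refine HasCompactSupport.of_support_subset_isCompact
      (isCompact_closedBall (0 : E) (R / 4)) ?_
    intro z hz
    rw [mem_closedBall_zero_iff]
    by_contra hlt
    exact hz (hφ0 z (not_le.1 hlt).le)
  have hconv : ContDiff ℝ (⊤ : ℕ∞) fun x => ∫ z, φ z * f (x - z) :=
    hφc.contDiff_convolution_left (ContinuousLinearMap.mul ℝ ℝ) (μ := (volume : Measure E)) hφ
      hfs.continuous.locallyIntegrable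
  have hrep : u =ᶠ[𝓝 x₀]
      fun x => ((∫ z, φ z * f (x - z)) + c / 2 * ∫ z, ψ z) / ∫ z, φ z := by
    filter_upwards [Metric.ball_mem_nhds x₀ (show 0 < R / 4 by positivity)] with x hx
    rw [eq_div_iff hpos.ne', ← hfu (Metric.ball_subset_closedBall
      (Metric.ball_subset_ball (by linarith) hx))]
    refine mollify_eq_of_laplacian_eq_const hfs hfc (fun y hy => hfΔ y ?_) hφ hψ hφ0 hψ0 hφψ
    rw [Metric.mem_ball] at *
    linarith [dist_triangle y x x₀]
  exact (((hconv.add contDiff_const).div_const _).contDiffAt.congr_of_eventuallyEq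
    hrep).contDiffWithinAt

end Regularity

/-! ### Thin layers below a graph and the divergence theorem there. -/

section Layers

variable {E : Type*} [NormedAddCommGroup E] [InnerProductSpace ℝ E] {e : E} {g : (ℝ ∙ e)ᗮ → ℝ}

theorem graphHeight_le_zero_of_graphMap_add (he : ‖e‖ = 1) (y : (ℝ ∙ e)ᗮ) {t : ℝ} (ht : t ≤ 0) :
    graphHeight e g (graphMap e g y + t • e) ≤ 0 := by
  rwa [graphHeight_add_smul he]

variable [FiniteDimensional ℝ E] [MeasurableSpace E] [BorelSpace E]

/-- The decomposition of the space along `e` is a linear isometry for the Euclidean norm on the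
product, hence the passage through `WithLp 2`. -/
theorem measurePreserving_coe_add_smul (he : ‖e‖ = 1) :
    MeasurePreserving (fun p : (ℝ ∙ e)ᗮ × ℝ => (p.1 : E) + p.2 • e) := by
  let L : WithLp 2 ((ℝ ∙ e)ᗮ × ℝ) →ₗᵢ[ℝ] E :=
    { toFun := fun p => (p.fst : E) + p.snd • e
      map_add' := fun p q => by simp; module
      map_smul' := fun c p => by simp [smul_smul]
      norm_map' := fun p => by
        rw [← sq_eq_sq₀ (norm_nonneg _) (norm_nonneg _), WithLp.prod_norm_sq_eq_of_L2]
        exact (norm_coe_add_smul_sq he p.fst p.snd).trans (by simp) }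
  have hsurj : Function.Surjective L := fun x =>
    ⟨WithLp.toLp 2 ((ℝ ∙ e)ᗮ.orthogonalProjectionOnto x, ⟪e, x⟫_ℝ),
      orthogonalProjectionOnto_add_inner_smul he x⟩
  exact (LinearIsometryEquiv.ofSurjective L hsurj).measurePreserving.comp
    (WithLp.volume_preserving_toLp (ℝ ∙ e)ᗮ ℝ)

/-- In these coordinates the map is a shear by `g` combined with a dilation by `ε` in the last
variable, so Lebesgue measure is multiplied by `ε⁻¹`. This turns layers of thickness of order `ε`
into a fixed strip. -/
theorem measurePreserving_graphMap_add_smul (he : ‖e‖ = 1) (hg : Continuous g) {ε : ℝ}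
    (hε : 0 < ε) :
    MeasurePreserving (fun p : (ℝ ∙ e)ᗮ × ℝ => graphMap e g p.1 + (ε * p.2) • e) volume
      (ENNReal.ofReal ε⁻¹ • volume) := by
  have h1 : ∀ y, Measure.map (fun s => ε * s + g y) (volume : Measure ℝ)
      = ENNReal.ofReal ε⁻¹ • volume := by
    intro y
    have : (fun s => ε * s + g y) = (fun s => s + g y) ∘ fun s => ε * s := rfl
    rw [this, ← Measure.map_map (by fun_prop) (by fun_prop), Real.map_volume_mul_left hε.ne',
      Measure.map_smul, map_add_right_eq_self, abs_of_pos (by positivity)]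
  have h2 : MeasurePreserving (fun p : (ℝ ∙ e)ᗮ × ℝ => (p.1, ε * p.2 + g p.1)) volume
      (ENNReal.ofReal ε⁻¹ • volume) := by
    have := (MeasurePreserving.id (volume : Measure (ℝ ∙ e)ᗮ)).skew_product
      (g := fun y s => ε * s + g y) (μc := volume) (by fun_prop)
      (Eventually.of_forall h1)
    rwa [Measure.prod_smul_right] at this
  have h3 := ((measurePreserving_coe_add_smul he).smul_measure (ENNReal.ofReal ε⁻¹)).comp h2
  convert! h3 using 1
  ext p
  simp only [graphMap, Function.comp_apply]
  module

theorem integral_comp_graphMap_add_smul (he : ‖e‖ = 1) (hg : Continuous g) {ε : ℝ}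
    (hε : 0 < ε) (h : E → ℝ) :
    ∫ p : (ℝ ∙ e)ᗮ × ℝ, h (graphMap e g p.1 + (ε * p.2) • e) = ε⁻¹ * ∫ x, h x := by
  have hemb : MeasurableEmbedding
      (fun p : (ℝ ∙ e)ᗮ × ℝ => graphMap e g p.1 + (ε * p.2) • e) := by
    refine (Function.LeftInverse.isClosedEmbedding
      (f := fun x => ((ℝ ∙ e)ᗮ.orthogonalProjectionOnto x, graphHeight e g x / ε))
      ?_ ?_ ?_).measurableEmbedding
    · intro p
      ext1
      · simp only [graphMap, add_assoc, ← add_smul]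
        exact orthogonalProjectionOnto_add_smul_self _ _
      · simp only [graphHeight_add_smul he]
        field_simp
    · have := (contDiff_graphHeight (n := 0) (contDiff_zero.2 hg)).continuous
      fun_prop
    · have := continuous_graphMap hg
      fun_prop
  rw [(measurePreserving_graphMap_add_smul he hg hε).integral_comp hemb,
    integral_smul_measure, ENNReal.toReal_ofReal (by positivity), smul_eq_mul]

/-- Weighted integrals over thin layers below a graph converge to the integral over the graph. -/
theorem tendsto_integral_layer (he : ‖e‖ = 1) (hg : Continuous g) {ρ : ℝ → ℝ}
    (hρ : Continuous ρ) (hρc : HasCompactSupport ρ) (hρ0 : ∀ s, 0 ≤ s → ρ s = 0) {h : E → ℝ}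
    (hh : ContinuousOn h {x | graphHeight e g x ≤ 0}) {K : Set E} (hK : IsCompact K)
    (hhK : ∀ x ∉ K, h x = 0) :
    Tendsto (fun ε : ℝ => ε⁻¹ * ∫ x, ρ (graphHeight e g x / ε) * h x) (𝓝[>] 0)
      (𝓝 ((∫ s, ρ s) * ∫ y, h (graphMap e g y))) := by
  have hGc : Continuous (graphHeight e g) :=
    (contDiff_graphHeight (n := 0) (contDiff_zero.2 hg)).continuous
  have hfc := continuous_graphMap (e := e) hg
  set D : Set E := {x | graphHeight e g x ≤ 0}
  have hD : IsClosed D := isClosed_le hGc continuous_const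
  -- Nothing is known about `h` above the graph. The weight `ρ` vanishes there, so `h` may be
  -- replaced by its restriction `k`, which is measurable and bounded.
  set k : E → ℝ := D.indicator h
  have hkm : Measurable k := hh.measurable_piecewise continuousOn_const hD.measurableSet
  obtain ⟨C, hC⟩ : ∃ C, ∀ x, ‖k x‖ ≤ C := by
    obtain ⟨C, hC⟩ := (hK.inter_right hD).exists_bound_of_continuousOn (hh.mono inter_subset_right)
    refine ⟨max C 0, fun x => ?_⟩
    by_cases hxD : x ∈ D
    · by_cases hxK : x ∈ K
      · simpa [k, hxD] using Or.inl (hC x ⟨hxK, hxD⟩)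
      · simp [k, hxD, hhK x hxK]
    · simp [k, hxD]
  set P : Set (ℝ ∙ e)ᗮ := (ℝ ∙ e)ᗮ.orthogonalProjectionOnto '' K
  have hP : IsCompact P := hK.image (ContinuousLinearMap.continuous _)
  have hkP : ∀ (y : (ℝ ∙ e)ᗮ) (t : ℝ), y ∉ P → k (graphMap e g y + t • e) = 0 := by
    intro y t hy
    refine indicator_apply_eq_zero.2 fun _ => hhK _ fun hmem => hy ⟨_, hmem, ?_⟩
    rw [graphMap, add_assoc, ← add_smul]
    exact orthogonalProjectionOnto_add_smul_self _ _
  have hrew : ∀ ε > (0 : ℝ), ε⁻¹ * ∫ x, ρ (graphHeight e g x / ε) * h x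
      = ∫ p : (ℝ ∙ e)ᗮ × ℝ, k (graphMap e g p.1 + (ε * p.2) • e) * ρ p.2 := by
    intro ε hε
    rw [← integral_comp_graphMap_add_smul he hg hε]
    refine integral_congr_ae (Eventually.of_forall fun p => ?_)
    simp only [graphHeight_add_smul he, mul_div_cancel_left₀ _ hε.ne']
    rw [mul_comm]
    rcases le_or_gt 0 p.2 with hp | hp
    · simp [hρ0 _ hp]
    · congr 1
      refine (indicator_of_mem ?_ h).symm
      exact graphHeight_le_zero_of_graphMap_add he _ (mul_nonpos_of_nonneg_of_nonpos hε.le hp.le)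
  have hlim : (∫ s, ρ s) * ∫ y, h (graphMap e g y)
      = ∫ p : (ℝ ∙ e)ᗮ × ℝ, h (graphMap e g p.1) * ρ p.2 := by
    rw [mul_comm]
    exact (integral_prod_mul (fun y => h (graphMap e g y)) ρ).symm
  rw [hlim]
  refine Tendsto.congr' (eventually_mem_nhdsWithin.mono fun ε hε => (hrew ε hε).symm) ?_
  refine tendsto_integral_filter_of_dominated_convergence
    -- After rescaling, every integrand is dominated by the same function, supported over the
    -- compact shadow `P` of `K`.
    (fun p : (ℝ ∙ e)ᗮ × ℝ => P.indicator (fun _ => C) p.1 * |ρ p.2|) ?_ ?_ ?_ ?_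
  · refine Eventually.of_forall fun ε => Measurable.aestronglyMeasurable ?_
    exact (hkm.comp (by fun_prop : Continuous fun p : (ℝ ∙ e)ᗮ × ℝ =>
      graphMap e g p.1 + (ε * p.2) • e).measurable).mul (hρ.measurable.comp measurable_snd)
  · refine Eventually.of_forall fun ε => Eventually.of_forall fun p => ?_
    rw [norm_mul, Real.norm_eq_abs (ρ p.2)]
    gcongr
    by_cases hp : p.1 ∈ P
    · rw [indicator_of_mem hp]; exact hC _
    · rw [hkP _ _ hp, indicator_of_notMem hp, norm_zero]
  · refine Integrable.mul_prod (f := P.indicator fun _ => C) (g := fun s => |ρ s|) ?_ ?_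
    · exact (integrable_indicator_iff hP.measurableSet).2
        (integrableOn_const hP.measure_lt_top.ne)
    · exact (hρ.integrable_of_hasCompactSupport hρc).abs
  · refine Eventually.of_forall fun p => ?_
    rcases le_or_gt 0 p.2 with hp | hp
    · simp [hρ0 _ hp]
    · refine Tendsto.mul_const _ ?_
      have h0 : graphMap e g p.1 ∈ D := (graphHeight_graphMap he p.1).le
      have hc : Tendsto (fun ε : ℝ => graphMap e g p.1 + (ε * p.2) • e) (𝓝[>] 0)
          (𝓝[D] graphMap e g p.1) := by
        refine tendsto_nhdsWithin_iff.2 ⟨?_, ?_⟩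
        · have : Continuous fun ε : ℝ => graphMap e g p.1 + (ε * p.2) • e := by fun_prop
          simpa using (this.tendsto 0).mono_left (nhdsWithin_le_nhds (s := Ioi 0))
        · exact eventually_mem_nhdsWithin.mono fun ε hε =>
            graphHeight_le_zero_of_graphMap_add he _
              (mul_nonpos_of_nonneg_of_nonpos (le_of_lt hε) hp.le)
      refine ((hh _ h0).tendsto.comp hc).congr' ?_
      filter_upwards [hc.eventually eventually_mem_nhdsWithin] with ε hε
      exact (indicator_of_mem hε h).symm

/-- Vanishing of the integral of the divergence of a field cut off near a graph. -/
theorem integrable_and_integral_cutoff_divergence_eq_zero (hg : ContDiff ℝ 1 g) {θ : ℝ → ℝ}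
    (hθ : ContDiff ℝ 1 θ) (hθ0 : ∀ s, -1 ≤ s → θ s = 0) {F : E → E}
    (hF : ContDiffOn ℝ 1 F {x | graphHeight e g x < 0}) {K : Set E} (hK : IsCompact K)
    (hFK : ∀ x ∉ K, F x = 0) {ε : ℝ} (hε : 0 < ε) :
    Integrable (fun x => θ (graphHeight e g x / ε) * divergence F x
      + ε⁻¹ * deriv θ (graphHeight e g x / ε) * ⟪gradient (graphHeight e g) x, F x⟫_ℝ) ∧
    ∫ x, (θ (graphHeight e g x / ε) * divergence F x
      + ε⁻¹ * deriv θ (graphHeight e g x / ε) * ⟪gradient (graphHeight e g) x, F x⟫_ℝ) = 0 := by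
  have hG := contDiff_graphHeight (e := e) hg
  set G := graphHeight e g
  have hopen : IsOpen {x | G x < 0} := isOpen_lt hG.continuous continuous_const
  have hθG : ContDiff ℝ 1 fun x => θ (G x / ε) := hθ.comp (hG.div_const ε)
  -- The cutoff vanishes on the open set `{G > -ε}`, a neighbourhood of the graph and of everything
  -- above it. Hence the cut-off field is `C¹` everywhere although `F` is so only strictly below.
  have hfar : ∀ x, 0 ≤ G x → (fun y => θ (G y / ε)) =ᶠ[𝓝 x] fun _ => 0 := by
    intro x hx
    have : ∀ᶠ y in 𝓝 x, -ε < G y :=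
      hG.continuous.continuousAt.eventually_const_lt (by linarith)
    filter_upwards [this] with y hy
    refine hθ0 _ ?_
    rw [le_div_iff₀ hε]
    linarith
  have hV : ContDiff ℝ 1 fun x => θ (G x / ε) • F x := by
    rw [contDiff_iff_contDiffAt]
    intro x
    rcases lt_or_ge (G x) 0 with hx | hx
    · exact hθG.contDiffAt.smul (hF.contDiffAt (hopen.mem_nhds hx))
    · refine contDiffAt_const (c := (0 : E)).congr_of_eventuallyEq ?_
      filter_upwards [hfar x hx] with y hy
      rw [hy, zero_smul]
  have hVc : HasCompactSupport fun x => θ (G x / ε) • F x := by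
    refine HasCompactSupport.of_support_subset_isCompact hK fun x hx => ?_
    by_contra hxK
    exact hx (by simp only [hFK x hxK, smul_zero])
  have hVint : Integrable (divergence fun x => θ (G x / ε) • F x) := by
    refine Continuous.integrable_of_hasCompactSupport
      ((traceL E).continuous.comp (hV.continuous_fderiv one_ne_zero)) ?_
    exact (hVc.fderiv (𝕜 := ℝ)).comp_left (map_zero _)
  suffices h : (fun x => θ (G x / ε) * divergence F x
      + ε⁻¹ * deriv θ (G x / ε) * ⟪gradient G x, F x⟫_ℝ) = divergence fun x => θ (G x / ε) • F x by
    rw [h]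
    exact ⟨hVint, integral_divergence_eq_zero hV hVc⟩
  ext x
  have hd : HasFDerivAt (fun y => θ (G y / ε))
      ((deriv θ (G x / ε) * ε⁻¹) • fderiv ℝ G x) x := by
    have h1 : HasFDerivAt (fun y => G y / ε) (ε⁻¹ • fderiv ℝ G x) x := by
      have := ((hG.differentiable one_ne_zero x).hasFDerivAt).mul_const ε⁻¹
      simpa only [div_eq_mul_inv] using this
    have h2 := ((hθ.differentiable one_ne_zero (G x / ε)).hasDerivAt).comp_hasFDerivAt x h1
    rwa [smul_smul] at h2
  rcases lt_or_ge (G x) 0 with hx | hx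
  · rw [divergence_smul hd.differentiableAt
      ((hF.contDiffAt (hopen.mem_nhds hx)).differentiableAt one_ne_zero), hd.fderiv,
      smul_apply, inner_gradient_left', smul_eq_mul]
    ring
  · have h0 : (fun y => θ (G y / ε) • F y) =ᶠ[𝓝 x] fun _ => 0 := by
      filter_upwards [hfar x hx] with y hy
      rw [hy, zero_smul]
    have h1 : deriv θ (G x / ε) = 0 := by
      have : θ =ᶠ[𝓝 (G x / ε)] fun _ => 0 := by
        have hpos : -1 < G x / ε := by rw [lt_div_iff₀ hε]; linarith
        filter_upwards [Ioi_mem_nhds hpos] with s hs using hθ0 s (le_of_lt hs)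
      rw [this.deriv_eq, deriv_const]
    rw [(hfar x hx).eq_of_nhds, h1, divergence, divergence, h0.fderiv_eq]
    simp

/-- A smooth cutoff equal to `1` on `(-∞, -2]` and to `0` on `[-1, ∞)`. -/
noncomputable def layerCutoff (s : ℝ) : ℝ := Real.smoothTransition (-1 - s)

theorem contDiff_layerCutoff {n : ℕ∞} : ContDiff ℝ n layerCutoff :=
  Real.smoothTransition.contDiff.comp (contDiff_const.sub contDiff_id)

theorem layerCutoff_eq_zero {s : ℝ} (hs : -1 ≤ s) : layerCutoff s = 0 :=
  Real.smoothTransition.zero_of_nonpos (by linarith)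

theorem layerCutoff_eq_one {s : ℝ} (hs : s ≤ -2) : layerCutoff s = 1 :=
  Real.smoothTransition.one_of_one_le (by linarith)

theorem contDiff_deriv_layerCutoff : ContDiff ℝ 1 (deriv layerCutoff) :=
  (contDiff_layerCutoff (n := 2)).deriv' (n := 1)

theorem deriv_layerCutoff_eq_zero {s : ℝ} (hs : -1 ≤ s ∨ s ≤ -2) : deriv layerCutoff s = 0 := by
  have hc := contDiff_deriv_layerCutoff.continuous
  rcases hs with hs | hs
  · have : EqOn (deriv layerCutoff) (fun _ => 0) (Ioi (-1)) := by
      intro t ht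
      have : layerCutoff =ᶠ[𝓝 t] fun _ => 0 := by
        filter_upwards [Ioi_mem_nhds ht] with r hr using layerCutoff_eq_zero (le_of_lt hr)
      rw [this.deriv_eq, deriv_const]
    exact this.of_subset_closure hc.continuousOn continuousOn_const
      Ioi_subset_Ici_self (by rw [closure_Ioi]) hs
  · have : EqOn (deriv layerCutoff) (fun _ => 0) (Iio (-2)) := by
      intro t ht
      have : layerCutoff =ᶠ[𝓝 t] fun _ => 1 := by
        filter_upwards [Iio_mem_nhds ht] with r hr using layerCutoff_eq_one (le_of_lt hr)
      rw [this.deriv_eq, deriv_const]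
    exact this.of_subset_closure hc.continuousOn continuousOn_const
      Iio_subset_Iic_self (by rw [closure_Iio]) hs

theorem hasCompactSupport_deriv_layerCutoff : HasCompactSupport (deriv layerCutoff) := by
  refine HasCompactSupport.of_support_subset_isCompact (isCompact_Icc (a := (-2 : ℝ)) (b := -1)) ?_
  intro s hs
  by_contra hmem
  refine hs (deriv_layerCutoff_eq_zero ?_)
  by_contra! h
  exact hmem ⟨h.2.le, h.1.le⟩

theorem integral_deriv_layerCutoff : ∫ s, deriv layerCutoff s = -1 := by
  have hsupp : Function.support (deriv layerCutoff) ⊆ Ioc (-2) (-1) := by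
    intro s hs
    by_contra hmem
    refine hs (deriv_layerCutoff_eq_zero ?_)
    by_contra! h
    exact hmem ⟨h.2, h.1.le⟩
  rw [← intervalIntegral.integral_eq_integral_of_support_subset hsupp,
    intervalIntegral.integral_deriv_eq_sub
      (fun s _ => (contDiff_layerCutoff (n := 1)).differentiable one_ne_zero s)
      (contDiff_deriv_layerCutoff.continuous.intervalIntegrable _ _),
    layerCutoff_eq_zero le_rfl, layerCutoff_eq_one le_rfl]
  norm_num

/-- The divergence theorem below a graph. -/
theorem setIntegral_divergence_below_graph (he : ‖e‖ = 1) (hg : ContDiff ℝ 1 g) {F : E → E}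
    (hF : ContDiffOn ℝ 1 F {x | graphHeight e g x < 0})
    (hFc : ContinuousOn F {x | graphHeight e g x ≤ 0}) {K : Set E} (hK : IsCompact K)
    (hFK : ∀ x ∉ K, F x = 0) (hint : IntegrableOn (divergence F) {x | graphHeight e g x < 0}) :
    ∫ x in {x | graphHeight e g x < 0}, divergence F x
      = ∫ y, ⟪gradient (graphHeight e g) (graphMap e g y), F (graphMap e g y)⟫_ℝ := by
  have hG := contDiff_graphHeight (e := e) hg
  have hgrad : Continuous (gradient (graphHeight e g)) :=
    (ContDiff.gradient (n := 0) (by simpa using hG)).continuous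
  have hopen : IsOpen {x | graphHeight e g x < 0} := isOpen_lt hG.continuous continuous_const
  have hlay := tendsto_integral_layer he hg.continuous contDiff_deriv_layerCutoff.continuous
    hasCompactSupport_deriv_layerCutoff
    (fun s hs => deriv_layerCutoff_eq_zero (Or.inl (by linarith)))
    (h := fun x => ⟪gradient (graphHeight e g) x, F x⟫_ℝ)
    (hgrad.continuousOn.inner hFc) hK (fun x hx => by simp [hFK x hx])
  rw [integral_deriv_layerCutoff, neg_one_mul] at hlay
  have hχ : ∀ s, 0 ≤ layerCutoff s ∧ layerCutoff s ≤ 1 := fun s =>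
    ⟨Real.smoothTransition.nonneg _, Real.smoothTransition.le_one _⟩
  have hχc : Continuous layerCutoff := (contDiff_layerCutoff (n := 0)).continuous
  have hmeas : ∀ ε : ℝ, AEStronglyMeasurable
      (fun x => layerCutoff (graphHeight e g x / ε) * divergence F x)
      (volume.restrict {x | graphHeight e g x < 0}) := fun ε =>
    (hχc.comp (hG.continuous.div_const ε)).aestronglyMeasurable.mul hint.aestronglyMeasurable
  have hbd : ∀ ε x : ℝ, ∀ z, ‖layerCutoff (x / ε) * divergence F z‖ ≤ ‖divergence F z‖ := by
    intro ε x z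
    rw [norm_mul, Real.norm_eq_abs, abs_of_nonneg (hχ _).1]
    exact mul_le_of_le_one_left (norm_nonneg _) (hχ _).2
  have hbulk : Tendsto (fun ε : ℝ => ∫ x in {x | graphHeight e g x < 0},
      layerCutoff (graphHeight e g x / ε) * divergence F x) (𝓝[>] 0)
      (𝓝 (∫ x in {x | graphHeight e g x < 0}, divergence F x)) := by
    refine tendsto_integral_filter_of_dominated_convergence (fun x => ‖divergence F x‖)
      (Eventually.of_forall hmeas)
      (Eventually.of_forall fun ε => Eventually.of_forall fun x => hbd _ _ _) hint.norm ?_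
    refine (ae_restrict_iff' hopen.measurableSet).2 (Eventually.of_forall fun x hx => ?_)
    refine tendsto_const_nhds.congr' ?_
    -- For `ε < -G(x)/2` one has `G(x)/ε ≤ -2`, where the cutoff equals `1`.
    have hx' : 0 < -graphHeight e g x / 2 := by
      have : graphHeight e g x < 0 := hx
      linarith
    filter_upwards [Ioo_mem_nhdsGT hx'] with ε hε
    rw [layerCutoff_eq_one, one_mul]
    rw [div_le_iff₀ hε.1]
    linarith [hε.2]
  have hlay' := hlay.neg
  rw [neg_neg] at hlay'
  refine tendsto_nhds_unique hbulk (hlay'.congr' ?_)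
  filter_upwards [eventually_mem_nhdsWithin] with ε hε
  have hε : 0 < ε := hε
  obtain ⟨hsum, hzero⟩ := integrable_and_integral_cutoff_divergence_eq_zero hg (contDiff_layerCutoff (n := 1))
    (fun s hs => layerCutoff_eq_zero hs) hF hK hFK hε
  have hsub : ∀ x, x ∉ {x | graphHeight e g x < 0} →
      layerCutoff (graphHeight e g x / ε) * divergence F x = 0 := by
    intro x hx
    rw [layerCutoff_eq_zero, zero_mul]
    have h0 : 0 ≤ graphHeight e g x := not_lt.1 hx
    have : 0 ≤ graphHeight e g x / ε := by positivity
    linarith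
  have hi1 : Integrable fun x => layerCutoff (graphHeight e g x / ε) * divergence F x := by
    rw [← integrableOn_iff_integrable_of_support_subset
      (s := {x | graphHeight e g x < 0}) (fun x hx => not_not.1 fun h => hx (hsub x h))]
    exact Integrable.mono hint (hmeas ε) (Eventually.of_forall fun x => hbd _ _ _)
  have hi2 : Integrable fun x => ε⁻¹ * deriv layerCutoff (graphHeight e g x / ε) *
      ⟪gradient (graphHeight e g) x, F x⟫_ℝ := by
    refine (hsum.sub hi1).congr (Eventually.of_forall fun x => ?_)
    simp only [Pi.sub_apply]
    ring
  rw [integral_add hi1 hi2] at hzero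
  rw [setIntegral_eq_integral_of_forall_compl_eq_zero hsub, eq_neg_of_add_eq_zero_left hzero]
  simp only [mul_assoc]
  rw [integral_const_mul]

end Layers

/-! ### The unit normal of a graph and the tangential divergence theorem. -/

section GraphNormal

variable {E : Type*} [NormedAddCommGroup E] [InnerProductSpace ℝ E] [FiniteDimensional ℝ E]
  {e : E} {g : (ℝ ∙ e)ᗮ → ℝ}

/-- The upward unit normal of a graph, extended to be constant in the direction `e`. -/
noncomputable def graphNormal (e : E) (g : (ℝ ∙ e)ᗮ → ℝ) (x : E) : E :=
  ‖gradient (graphHeight e g) x‖⁻¹ • gradient (graphHeight e g) x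

theorem norm_gradient_graphHeight_pos (he : ‖e‖ = 1) (hg : ContDiff ℝ 1 g) (x : E) :
    0 < ‖gradient (graphHeight e g) x‖ :=
  one_pos.trans_le (one_le_norm_gradient_graphHeight he hg x)

theorem norm_graphNormal (he : ‖e‖ = 1) (hg : ContDiff ℝ 1 g) (x : E) :
    ‖graphNormal e g x‖ = 1 := by
  rw [graphNormal, norm_smul, norm_inv, norm_norm,
    inv_mul_cancel₀ (norm_gradient_graphHeight_pos he hg x).ne']

theorem gradient_graphHeight_eq_smul (he : ‖e‖ = 1) (hg : ContDiff ℝ 1 g) (x : E) :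
    gradient (graphHeight e g) x = ‖gradient (graphHeight e g) x‖ • graphNormal e g x := by
  rw [graphNormal, smul_inv_smul₀ (norm_gradient_graphHeight_pos he hg x).ne']

theorem contDiff_gradient_graphHeight (hg : ContDiff ℝ 2 g) :
    ContDiff ℝ 1 (gradient (graphHeight e g)) :=
  ContDiff.gradient (contDiff_graphHeight (by rwa [one_add_one_eq_two]))

theorem contDiff_norm_gradient_graphHeight (he : ‖e‖ = 1) (hg : ContDiff ℝ 2 g) :
    ContDiff ℝ 1 fun x => ‖gradient (graphHeight e g) x‖ :=
  (contDiff_gradient_graphHeight hg).norm ℝ fun x =>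
    norm_pos_iff.1 (norm_gradient_graphHeight_pos he (hg.of_le one_le_two) x)

theorem contDiff_graphNormal (he : ‖e‖ = 1) (hg : ContDiff ℝ 2 g) :
    ContDiff ℝ 1 (graphNormal e g) :=
  ((contDiff_norm_gradient_graphHeight he hg).inv fun x =>
    (norm_gradient_graphHeight_pos he (hg.of_le one_le_two) x).ne').smul
      (contDiff_gradient_graphHeight hg)

/-- Differentiate `|n|² = 1`, which holds in the whole space and not only on the graph. -/
theorem inner_fderiv_graphNormal_self (he : ‖e‖ = 1) (hg : ContDiff ℝ 2 g) (x v : E) :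
    ⟪fderiv ℝ (graphNormal e g) x v, graphNormal e g x⟫_ℝ = 0 := by
  have hd := ((contDiff_graphNormal he hg).differentiable one_ne_zero x).hasFDerivAt
  have h1 := hd.inner ℝ hd
  have h2 : (fun y => ⟪graphNormal e g y, graphNormal e g y⟫_ℝ) = fun _ => 1 := by
    ext y
    rw [real_inner_self_eq_norm_sq, norm_graphNormal he (hg.of_le one_le_two), one_pow]
  rw [h2] at h1
  have h3 := congrArg (fun l => l v) (h1.unique (hasFDerivAt_const (1 : ℝ) x))
  simp [real_inner_comm] at h3
  rw [real_inner_comm]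
  exact h3

/-- Symmetry of the Hessian of the height function, in terms of the unit normal. -/
theorem fderiv_norm_gradient_graphHeight (he : ‖e‖ = 1) (hg : ContDiff ℝ 2 g) (x v : E) :
    fderiv ℝ (fun x => ‖gradient (graphHeight e g) x‖) x v
      = fderiv ℝ (fun x => ‖gradient (graphHeight e g) x‖) x (graphNormal e g x)
          * ⟪graphNormal e g x, v⟫_ℝ
        + ‖gradient (graphHeight e g) x‖
          * ⟪fderiv ℝ (graphNormal e g) x (graphNormal e g x), v⟫_ℝ := by
  have hg1 : ContDiff ℝ 1 g := hg.of_le one_le_two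
  set m := fun x => ‖gradient (graphHeight e g) x‖ with hm
  set n := graphNormal e g with hn
  have hmd : DifferentiableAt ℝ m x :=
    (contDiff_norm_gradient_graphHeight he hg).differentiable one_ne_zero x
  have hnd : DifferentiableAt ℝ n x := (contDiff_graphNormal he hg).differentiable one_ne_zero x
  have hG := contDiff_graphHeight (e := e) hg
  have hGd : DifferentiableAt ℝ (fderiv ℝ (graphHeight e g)) x :=
    (hG.fderiv_right (m := 1) (by norm_num)).differentiable one_ne_zero x
  have h1 : gradient (graphHeight e g) = fun x => m x • n x :=
    funext fun x => gradient_graphHeight_eq_smul he hg1 x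
  have h2 : ∀ v w, ⟪fderiv ℝ (gradient (graphHeight e g)) x v, w⟫_ℝ
      = fderiv ℝ (fderiv ℝ (graphHeight e g)) x v w := by
    intro v w
    have : fderiv ℝ (gradient (graphHeight e g)) x
        = (rieszL E).comp (fderiv ℝ (fderiv ℝ (graphHeight e g)) x) :=
      ((rieszL E).hasFDerivAt.comp x hGd.hasFDerivAt).fderiv
    rw [this, ContinuousLinearMap.comp_apply, inner_rieszL]
  have h3 : ∀ v w, ⟪fderiv ℝ (gradient (graphHeight e g)) x v, w⟫_ℝ
      = m x * ⟪fderiv ℝ n x v, w⟫_ℝ + fderiv ℝ m x v * ⟪n x, w⟫_ℝ := by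
    intro v w
    rw [h1, fderiv_fun_smul hmd hnd, add_apply, inner_add_left, smul_apply,
      ContinuousLinearMap.smulRight_apply, real_inner_smul_left, real_inner_smul_left]
  have hsymm : IsSymmSndFDerivAt ℝ (graphHeight e g) x :=
    hG.contDiffAt.isSymmSndFDerivAt (by simp)
  -- With `∇G = m n`, the Hessian at `(v, n)` is `∂ᵥm`, since `∂ᵥn` is orthogonal to `n`. At `(n,
  -- v)` it is `∂ₙm ⟨n, v⟩ + m⟨∂ₙn, v⟩`.
  have h4 := hsymm.eq v (n x)
  rw [← h2, ← h2, h3, h3, inner_fderiv_graphNormal_self he hg, real_inner_self_eq_norm_sq,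
    norm_graphNormal he hg1] at h4
  linarith

variable [MeasurableSpace E] [BorelSpace E]

/-- The tangential divergence theorem on a graph. -/
theorem integral_tangential_divergence_graph (he : ‖e‖ = 1) (hg : ContDiff ℝ 2 g) {X : E → E}
    {A : E → E →L[ℝ] E} (hX : ContDiffOn ℝ 1 X {x | graphHeight e g x < 0})
    (hXc : ContinuousOn X {x | graphHeight e g x ≤ 0})
    (hAc : ContinuousOn A {x | graphHeight e g x ≤ 0})
    (hXA : ∀ x, graphHeight e g x < 0 → fderiv ℝ X x = A x) {K : Set E} (hK : IsCompact K)
    (hXK : ∀ x ∉ K, X x = 0) (hAK : ∀ x ∉ K, A x = 0) :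
    ∫ y, ‖gradient (graphHeight e g) (graphMap e g y)‖ *
      (traceL E (A (graphMap e g y))
        - ⟪A (graphMap e g y) (graphNormal e g (graphMap e g y)),
            graphNormal e g (graphMap e g y)⟫_ℝ
        - traceL E (fderiv ℝ (graphNormal e g) (graphMap e g y))
          * ⟪X (graphMap e g y), graphNormal e g (graphMap e g y)⟫_ℝ) = 0 := by
  have hg1 : ContDiff ℝ 1 g := hg.of_le one_le_two
  set G := graphHeight e g with hGdef
  set m := fun x => ‖gradient G x‖ with hm
  set n := graphNormal e g with hn
  have hmC : ContDiff ℝ 1 m := contDiff_norm_gradient_graphHeight he hg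
  have hnC : ContDiff ℝ 1 n := contDiff_graphNormal he hg
  have hG := contDiff_graphHeight (e := e) hg
  have hopen : IsOpen {x | G x < 0} := isOpen_lt hG.continuous continuous_const
  set h : E → ℝ := fun x => m x * (traceL E (A x) - ⟪A x (n x), n x⟫_ℝ
    - traceL E (fderiv ℝ n x) * ⟪X x, n x⟫_ℝ) with hh
  -- The tangential part of `X`, weighted by the area density `m = |∇G|`. The weight makes the terms
  -- `⟨∂ₙn, X⟩` in the divergence cancel, by `fderiv_norm_gradient_graphHeight`.
  set w : E → E := fun x => m x • (X x - ⟪X x, n x⟫_ℝ • n x) with hw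
  have hwC : ContDiffOn ℝ 1 w {x | G x < 0} :=
    hmC.contDiffOn.smul (hX.sub ((hX.inner ℝ hnC.contDiffOn).smul hnC.contDiffOn))
  have hwK : ∀ x ∉ K, w x = 0 := fun x hx => by simp [hw, hXK x hx]
  have hnn : ∀ x, ⟪n x, n x⟫_ℝ = 1 := fun x => by
    rw [real_inner_self_eq_norm_sq, norm_graphNormal he hg1, one_pow]
  have hGw : ∀ x, ⟪gradient G x, w x⟫_ℝ = 0 := by
    intro x
    have : gradient G x = m x • n x := gradient_graphHeight_eq_smul he hg1 x
    rw [this, hw]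
    simp only [real_inner_smul_left, inner_smul_right, inner_sub_right, hnn]
    rw [real_inner_comm (n x)]
    ring
  have hdiv : ∀ x, G x < 0 → divergence w x = h x := by
    intro x hx
    have hXd := (hX.contDiffAt (hopen.mem_nhds hx)).differentiableAt one_ne_zero
    have hmd := hmC.differentiable one_ne_zero x
    have hnd := hnC.differentiable one_ne_zero x
    have hid : DifferentiableAt ℝ (fun y => ⟪X y, n y⟫_ℝ) x := hXd.inner ℝ hnd
    have hpd : DifferentiableAt ℝ (fun y => ⟪X y, n y⟫_ℝ • n y) x := hid.smul hnd
    have hsd : DifferentiableAt ℝ (fun y => X y - ⟪X y, n y⟫_ℝ • n y) x := hXd.sub hpd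
    have h1 : divergence (fun y => X y - ⟪X y, n y⟫_ℝ • n y) x
        = traceL E (A x) - divergence (fun y => ⟪X y, n y⟫_ℝ • n y) x := by
      rw [divergence, fderiv_fun_sub hXd hpd, map_sub, hXA x hx]
      rfl
    have h2 : ∀ v, fderiv ℝ (fun y => ⟪X y, n y⟫_ℝ) x v
        = ⟪X x, fderiv ℝ n x v⟫_ℝ + ⟪A x v, n x⟫_ℝ := by
      intro v
      rw [fderiv_inner_apply ℝ hXd hnd, hXA x hx]
    have h3 : fderiv ℝ m x (X x) = fderiv ℝ m x (n x) * ⟪n x, X x⟫_ℝ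
        + m x * ⟪fderiv ℝ n x (n x), X x⟫_ℝ := fderiv_norm_gradient_graphHeight he hg x (X x)
    rw [hw, divergence_smul hmd hsd, h1, divergence_smul hid hnd, h2,
      map_sub, map_smul, h3, smul_eq_mul, hh, divergence,
      real_inner_comm (fderiv ℝ n x (n x)) (X x)]
    simp only [real_inner_comm (n x) (X x)]
    ring
  have hlay := tendsto_integral_layer he hg1.continuous contDiff_deriv_layerCutoff.continuous
    hasCompactSupport_deriv_layerCutoff
    (fun s hs => deriv_layerCutoff_eq_zero (Or.inl (by linarith))) (h := h)
    (hmC.continuous.continuousOn.mul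
      ((((traceL E).continuous.comp_continuousOn hAc).sub
        ((hAc.clm_apply hnC.continuous.continuousOn).inner hnC.continuous.continuousOn)).sub
        (((traceL E).continuous.comp (hnC.continuous_fderiv one_ne_zero)).continuousOn.mul
          (hXc.inner hnC.continuous.continuousOn))))
    hK (fun x hx => by simp [hh, hXK x hx, hAK x hx])
  -- The cutoff identity is applied with `deriv layerCutoff` in place of the cutoff. Since `w` is
  -- tangent to the level sets of `G`, the term with the second derivative of the cutoff vanishes.
  -- The layer integrals of `div w` are therefore zero for every `ε`, and so is their limit on the
  -- graph.
  have hzero : ∀ ε > (0 : ℝ), ε⁻¹ * ∫ x, deriv layerCutoff (G x / ε) * h x = 0 := by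
    intro ε hε
    have := (integrable_and_integral_cutoff_divergence_eq_zero hg1 contDiff_deriv_layerCutoff
      (fun s hs => deriv_layerCutoff_eq_zero (Or.inl hs)) hwC hK hwK hε).2
    rw [mul_eq_zero, ← this]
    right
    refine integral_congr_ae (Eventually.of_forall fun x => ?_)
    simp only [← hGdef, hGw, mul_zero, add_zero]
    rcases lt_or_ge (G x) 0 with hx | hx
    · rw [hdiv x hx]
    · have : 0 ≤ G x / ε := by positivity
      rw [deriv_layerCutoff_eq_zero (Or.inl (by linarith)), zero_mul, zero_mul]
  have hlay' : Tendsto (fun _ : ℝ => (0 : ℝ)) (𝓝[>] 0) _ :=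
    hlay.congr' (eventually_mem_nhdsWithin.mono fun ε hε => hzero ε hε)
  have hlim := tendsto_nhds_unique hlay' tendsto_const_nhds
  rw [integral_deriv_layerCutoff, neg_one_mul, neg_eq_zero] at hlim
  exact hlim

end GraphNormal

/-! ### Boundary charts: normal, curvature and surface measure. -/

section Chart

variable {N : ℕ} {Ω : Set (EuclideanSpace ℝ (Fin N))} {e x y : EuclideanSpace ℝ (Fin N)}
  {g : (ℝ ∙ e)ᗮ → ℝ} {r : ℝ}

/-- In the ball of radius `r` about `x`, the set `Ω` is the region below the graph of `g`. -/
structure IsGraphChart (Ω : Set (EuclideanSpace ℝ (Fin N))) (e : EuclideanSpace ℝ (Fin N))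
    (g : (ℝ ∙ e)ᗮ → ℝ) (x : EuclideanSpace ℝ (Fin N)) (r : ℝ) : Prop where
  norm_eq : ‖e‖ = 1
  contDiff : ContDiff ℝ 2 g
  mem_iff : ∀ y ∈ Metric.ball x r, y ∈ Ω ↔ graphHeight e g y < 0

theorem HasC2Boundary.exists_chart (h : HasC2Boundary Ω) (hx : x ∈ frontier Ω) :
    ∃ (e : EuclideanSpace ℝ (Fin N)) (g : (ℝ ∙ e)ᗮ → ℝ) (r : ℝ), 0 < r ∧ IsGraphChart Ω e g x r := by
  obtain ⟨e, g, r, he, hg, hr, H⟩ := h x hx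
  exact ⟨e, g, r, hr, he, hg, fun y hy => (H y hy).trans sub_neg.symm⟩

namespace IsGraphChart

theorem contDiff_one (h : IsGraphChart Ω e g x r) : ContDiff ℝ 1 g := h.contDiff.of_le one_le_two

theorem graphMap_add_graphHeight (h : IsGraphChart Ω e g x r) (y : EuclideanSpace ℝ (Fin N)) :
    graphMap e g ((ℝ ∙ e)ᗮ.orthogonalProjectionOnto y) + graphHeight e g y • e = y := by
  conv_rhs => rw [← orthogonalProjectionOnto_add_inner_smul h.norm_eq y]
  rw [graphMap, graphHeight]
  module

theorem graphHeight_add (h : IsGraphChart Ω e g x r) (y : EuclideanSpace ℝ (Fin N)) (t : ℝ) :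
    graphHeight e g (y + t • e) = graphHeight e g y + t := by
  conv_lhs => rw [← h.graphMap_add_graphHeight y]
  rw [add_assoc, ← add_smul, graphHeight_add_smul h.norm_eq]

theorem continuous_graphHeight (h : IsGraphChart Ω e g x r) : Continuous (graphHeight e g) :=
  (contDiff_graphHeight h.contDiff).continuous

theorem mem_closure_iff (h : IsGraphChart Ω e g x r) (hy : y ∈ Metric.ball x r) :
    y ∈ closure Ω ↔ graphHeight e g y ≤ 0 := by
  constructor
  · intro hyc
    have h1 : y ∈ closure (Metric.ball x r ∩ Ω) := Metric.isOpen_ball.inter_closure ⟨hy, hyc⟩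
    refine closure_minimal (fun z hz => ?_)
      (isClosed_le h.continuous_graphHeight continuous_const) h1
    exact ((h.mem_iff z hz.1).1 hz.2).le
  · intro hy0
    -- Moving down along `e` lowers the height strictly, so even points on the graph are limits of
    -- points of `Ω`.
    have hc : Tendsto (fun t : ℝ => y + (-t) • e) (𝓝[>] 0) (𝓝 y) := by
      have : Continuous fun t : ℝ => y + (-t) • e := by fun_prop
      simpa using (this.tendsto 0).mono_left (nhdsWithin_le_nhds (s := Ioi 0))
    refine mem_closure_of_tendsto hc ?_
    filter_upwards [hc.eventually (Metric.isOpen_ball.mem_nhds hy), self_mem_nhdsWithin]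
      with t ht ht0
    rw [h.mem_iff _ ht, h.graphHeight_add]
    have : (0 : ℝ) < t := ht0
    linarith

theorem mem_frontier_iff (h : IsGraphChart Ω e g x r) (hΩ : IsOpen Ω)
    (hy : y ∈ Metric.ball x r) : y ∈ frontier Ω ↔ graphHeight e g y = 0 := by
  rw [hΩ.frontier_eq, Set.mem_sdiff, h.mem_closure_iff hy, h.mem_iff y hy, not_lt, le_antisymm_iff]

theorem isOuterUnitNormal (h : IsGraphChart Ω e g x r) (hΩ : IsOpen Ω)
    (hy : y ∈ Metric.ball x r) (hyf : y ∈ frontier Ω) :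
    IsOuterUnitNormal Ω y (graphNormal e g y) := by
  refine ⟨norm_graphNormal h.norm_eq h.contDiff_one y, fun v => ?_⟩
  have hy0 := (h.mem_frontier_iff hΩ hy).1 hyf
  have hd : HasDerivAt (fun t : ℝ => graphHeight e g (y + t • v))
      ⟪gradient (graphHeight e g) y, v⟫_ℝ 0 := by
    have h1 : HasDerivAt (fun t : ℝ => y + t • v) v 0 := by
      simpa using ((hasDerivAt_id (0 : ℝ)).smul_const v).const_add y
    have h2 := ((contDiff_graphHeight h.contDiff).differentiable two_ne_zero y).hasFDerivAt
    rw [inner_gradient_left']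
    exact h2.comp_hasDerivAt_of_eq (0 : ℝ) h1 (by simp)
  have hin : ⟪v, graphNormal e g y⟫_ℝ
      = ‖gradient (graphHeight e g) y‖⁻¹ * ⟪gradient (graphHeight e g) y, v⟫_ℝ := by
    rw [graphNormal, inner_smul_right, real_inner_comm]
  have hm := inv_pos.2 (norm_gradient_graphHeight_pos h.norm_eq h.contDiff_one y)
  have hball : ∀ᶠ t : ℝ in 𝓝[>] 0, y + t • v ∈ Metric.ball x r := by
    have : Continuous fun t : ℝ => y + t • v := by fun_prop
    refine ((this.tendsto 0).mono_left nhdsWithin_le_nhds).eventually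
      (Metric.isOpen_ball.mem_nhds ?_)
    simpa using hy
  -- As the height vanishes at `y`, its sign along a short ray is that of its directional
  -- derivative.
  have hslope : Tendsto (fun t : ℝ => t⁻¹ * graphHeight e g (y + t • v)) (𝓝[>] 0)
      (𝓝 ⟪gradient (graphHeight e g) y, v⟫_ℝ) := by
    have := (hasDerivAt_iff_tendsto_slope_zero.1 hd).mono_left (nhdsGT_le_nhdsNE 0)
    simpa [hy0] using this
  rw [hin]
  constructor
  · intro hv
    have hv' : ⟪gradient (graphHeight e g) y, v⟫_ℝ < 0 := by
      by_contra! hcon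
      exact absurd hv (not_lt.2 (mul_nonneg hm.le hcon))
    filter_upwards [hball, hslope.eventually_lt_const hv', self_mem_nhdsWithin] with t h1 h2 h3
    rw [h.mem_iff _ h1]
    by_contra! hcon
    exact absurd h2 (not_lt.2 (mul_nonneg (inv_nonneg.2 (le_of_lt h3)) hcon))
  · intro hv
    have hv' : 0 < ⟪gradient (graphHeight e g) y, v⟫_ℝ := pos_of_mul_pos_right hv hm.le
    filter_upwards [hball, hslope.eventually_const_lt hv', self_mem_nhdsWithin] with t h1 h2 h3
    rw [h.mem_closure_iff h1, not_le]
    exact pos_of_mul_pos_right h2 (inv_nonneg.2 (le_of_lt h3))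

theorem outerNormal_eq (h : IsGraphChart Ω e g x r) (hΩ : IsOpen Ω)
    (hy : y ∈ Metric.ball x r) (hyf : y ∈ frontier Ω) : outerNormal Ω y = graphNormal e g y :=
  (h.isOuterUnitNormal hΩ hy hyf).outerNormal_eq

theorem hasFDerivWithinAt_outerNormal (h : IsGraphChart Ω e g x r) (hΩ : IsOpen Ω)
    (hy : y ∈ Metric.ball x r) (hyf : y ∈ frontier Ω) :
    HasFDerivWithinAt (outerNormal Ω) (fderiv ℝ (graphNormal e g) y) (frontier Ω) y := by
  have hd := ((contDiff_graphNormal h.norm_eq h.contDiff).differentiable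
    one_ne_zero y).hasFDerivAt.hasFDerivWithinAt (s := frontier Ω)
  refine hd.congr_of_eventuallyEq ?_ (h.outerNormal_eq hΩ hy hyf)
  filter_upwards [self_mem_nhdsWithin, mem_nhdsWithin_of_mem_nhds (Metric.isOpen_ball.mem_nhds hy)]
    with z hz hzb using h.outerNormal_eq hΩ hzb hz

theorem graphMap_projection (h : IsGraphChart Ω e g x r) (hΩ : IsOpen Ω)
    (hy : y ∈ Metric.ball x r) (hyf : y ∈ frontier Ω) :
    graphMap e g ((ℝ ∙ e)ᗮ.orthogonalProjectionOnto y) = y := by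
  conv_rhs => rw [← h.graphMap_add_graphHeight y]
  rw [(h.mem_frontier_iff hΩ hy).1 hyf, zero_smul, add_zero]

theorem eventually_graphMap_mem_frontier (h : IsGraphChart Ω e g x r) (hΩ : IsOpen Ω)
    (hy : y ∈ Metric.ball x r) (hyf : y ∈ frontier Ω) :
    ∀ᶠ p in 𝓝 ((ℝ ∙ e)ᗮ.orthogonalProjectionOnto y), graphMap e g p ∈ frontier Ω := by
  have hc := (continuous_graphMap (e := e) h.contDiff.continuous).tendsto
    ((ℝ ∙ e)ᗮ.orthogonalProjectionOnto y)
  rw [h.graphMap_projection hΩ hy hyf] at hc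
  filter_upwards [hc.eventually (Metric.isOpen_ball.mem_nhds hy)] with p hp
  exact (h.mem_frontier_iff hΩ hp).2 (graphHeight_graphMap h.norm_eq p)

/-- Vectors orthogonal to the normal are velocities of the parametrization. -/
theorem exists_fderiv_graphMap_eq (h : IsGraphChart Ω e g x r) {v : EuclideanSpace ℝ (Fin N)}
    (hv : ⟪gradient (graphHeight e g) y, v⟫_ℝ = 0) :
    fderiv ℝ (graphMap e g) ((ℝ ∙ e)ᗮ.orthogonalProjectionOnto y)
      ((ℝ ∙ e)ᗮ.orthogonalProjectionOnto v) = v := by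
  set p := (ℝ ∙ e)ᗮ.orthogonalProjectionOnto y with hp
  have h1 : HasFDerivAt (graphMap e g) ((ℝ ∙ e)ᗮ.subtypeL + (fderiv ℝ g p).smulRight e) p :=
    (ℝ ∙ e)ᗮ.subtypeL.hasFDerivAt.add
      ((h.contDiff.differentiable two_ne_zero p).hasFDerivAt.smul_const e)
  have h2 : fderiv ℝ g p ((ℝ ∙ e)ᗮ.orthogonalProjectionOnto v) = ⟪e, v⟫_ℝ := by
    rw [gradient_graphHeight h.contDiff_one, inner_sub_left, sub_eq_zero, ← hp] at hv
    rw [hv, ← Submodule.inner_orthogonalProjectionOnto_eq_of_mem_left]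
    exact (inner_gradient_left' g p _).symm
  rw [h1.fderiv]
  simp only [add_apply, ContinuousLinearMap.smulRight_apply, h2]
  exact orthogonalProjectionOnto_add_inner_smul h.norm_eq v

/-- Two derivatives along the boundary agree on tangent vectors. -/
theorem hasFDerivWithinAt_frontier_unique (h : IsGraphChart Ω e g x r) (hΩ : IsOpen Ω)
    (hy : y ∈ Metric.ball x r) (hyf : y ∈ frontier Ω) {F : Type*} [NormedAddCommGroup F]
    [NormedSpace ℝ F] {φ : EuclideanSpace ℝ (Fin N) → F}
    {A B : EuclideanSpace ℝ (Fin N) →L[ℝ] F} (hA : HasFDerivWithinAt φ A (frontier Ω) y)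
    (hB : HasFDerivWithinAt φ B (frontier Ω) y) {v : EuclideanSpace ℝ (Fin N)}
    (hv : ⟪graphNormal e g y, v⟫_ℝ = 0) : A v = B v := by
  have hf := ((contDiff_graphMap (e := e) h.contDiff).differentiable two_ne_zero
    ((ℝ ∙ e)ᗮ.orthogonalProjectionOnto y)).hasFDerivAt
  have hev := h.eventually_graphMap_mem_frontier hΩ hy hyf
  have heq := (h.graphMap_projection hΩ hy hyf).symm
  have h1 := (hA.comp_hasFDerivAt_of_eq _ hf hev heq).unique
    (hB.comp_hasFDerivAt_of_eq _ hf hev heq)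
  have hv' : ⟪gradient (graphHeight e g) y, v⟫_ℝ = 0 := by
    rw [gradient_graphHeight_eq_smul h.norm_eq h.contDiff_one, real_inner_smul_left, hv, mul_zero]
  have h2 := congrArg (fun l => l ((ℝ ∙ e)ᗮ.orthogonalProjectionOnto v)) h1
  simpa only [ContinuousLinearMap.comp_apply, h.exists_fderiv_graphMap_eq hv'] using h2

/-- The derivative within the frontier is determined only on tangent vectors. The projection in
`gradNormal` discards the arbitrary normal part, so any differentiable extension of `ν`, such as
`graphNormal`, computes it. -/
theorem gradNormal_eq (h : IsGraphChart Ω e g x r) (hΩ : IsOpen Ω)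
    (hy : y ∈ Metric.ball x r) (hyf : y ∈ frontier Ω) :
    gradNormal Ω y = (fderiv ℝ (graphNormal e g) y).comp
      (ℝ ∙ graphNormal e g y)ᗮ.starProjection := by
  have hd := h.hasFDerivWithinAt_outerNormal hΩ hy hyf
  ext1 v
  simp only [gradNormal, h.outerNormal_eq hΩ hy hyf]
  exact h.hasFDerivWithinAt_frontier_unique hΩ hy hyf
    hd.differentiableWithinAt.hasFDerivWithinAt hd
    (Submodule.mem_orthogonal_singleton_iff_inner_right.1 (Submodule.starProjection_apply_mem _ v))

theorem gradNormal_apply (h : IsGraphChart Ω e g x r) (hΩ : IsOpen Ω)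
    (hy : y ∈ Metric.ball x r) (hyf : y ∈ frontier Ω) (v : EuclideanSpace ℝ (Fin N)) :
    gradNormal Ω y v = fderiv ℝ (graphNormal e g) y v
      - ⟪graphNormal e g y, v⟫_ℝ • fderiv ℝ (graphNormal e g) y (graphNormal e g y) := by
  rw [h.gradNormal_eq hΩ hy hyf, ContinuousLinearMap.comp_apply,
    Submodule.starProjection_orthogonal', sub_apply, one_apply_eq_self,
    Submodule.starProjection_unit_singleton ℝ (norm_graphNormal h.norm_eq h.contDiff_one y),
    map_sub, map_smul]

/-- The two maps differ by a rank-one map of trace `⟨n, ∂ₙn⟩ = 0`, so the normal extension does not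
affect the mean curvature. -/
theorem traceL_gradNormal (h : IsGraphChart Ω e g x r) (hΩ : IsOpen Ω)
    (hy : y ∈ Metric.ball x r) (hyf : y ∈ frontier Ω) :
    traceL _ (gradNormal Ω y) = traceL _ (fderiv ℝ (graphNormal e g) y) := by
  have h1 : gradNormal Ω y = fderiv ℝ (graphNormal e g) y
      - (innerSL ℝ (graphNormal e g y)).smulRight
        (fderiv ℝ (graphNormal e g) y (graphNormal e g y)) := by
    ext1 v
    rw [h.gradNormal_apply hΩ hy hyf]
    rfl
  rw [h1, map_sub, traceL_smulRight, innerSL_apply_apply, real_inner_comm,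
    inner_fderiv_graphNormal_self h.norm_eq h.contDiff, sub_zero]

end IsGraphChart

/-- The tangent cone contains the open half-space opposite to `n`, and every vector is a difference
of two elements of that half-space. This makes one-sided derivatives at the boundary well defined.
-/
theorem IsOuterUnitNormal.uniqueDiffWithinAt_closure {n : EuclideanSpace ℝ (Fin N)}
    (h : IsOuterUnitNormal Ω x n) (hx : x ∈ closure Ω) : UniqueDiffWithinAt ℝ (closure Ω) x := by
  refine ⟨?_, subset_closure hx⟩
  have hcone : ∀ v, ⟪v, n⟫_ℝ < 0 → v ∈ tangentConeAt ℝ (closure Ω) x := by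
    intro v hv
    refine mem_tangentConeAt_of_add_smul_mem (tendsto_id'.mpr <| nhdsGT_le_nhdsNE 0) ?_
    exact (((h.2 v).1 hv).mono fun t ht => subset_closure ht)
  have hspan : Submodule.span ℝ (tangentConeAt ℝ (closure Ω) x) = ⊤ := by
    rw [eq_top_iff]
    intro w _
    have hnn : ⟪n, n⟫_ℝ = 1 := by rw [real_inner_self_eq_norm_sq, h.1, one_pow]
    have h1 := Submodule.subset_span (R := ℝ) (hcone (-((|⟪w, n⟫_ℝ| + 1) • n)) (by
      rw [inner_neg_left, real_inner_smul_left, hnn]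
      have := abs_nonneg ⟪w, n⟫_ℝ
      linarith))
    have h2 := Submodule.subset_span (R := ℝ) (hcone (w - (|⟪w, n⟫_ℝ| + 1) • n) (by
      rw [inner_sub_left, real_inner_smul_left, hnn]
      have := le_abs_self ⟪w, n⟫_ℝ
      linarith))
    simpa using Submodule.sub_mem _ h2 h1
  rw [hspan]
  simp

theorem HasC2Boundary.isOuterUnitNormal (h : HasC2Boundary Ω) (hΩ : IsOpen Ω)
    (hx : x ∈ frontier Ω) : IsOuterUnitNormal Ω x (outerNormal Ω x) := by
  obtain ⟨e, g, r, hr, hc⟩ := h.exists_chart hx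
  have hxb := Metric.mem_ball_self (x := x) hr
  rw [hc.outerNormal_eq hΩ hxb hx]
  exact hc.isOuterUnitNormal hΩ hxb hx

theorem HasC2Boundary.uniqueDiffOn_closure (h : HasC2Boundary Ω) (hΩ : IsOpen Ω) :
    UniqueDiffOn ℝ (closure Ω) := by
  intro x hx
  by_cases hxΩ : x ∈ Ω
  · exact uniqueDiffWithinAt_of_mem_nhds
      (mem_of_superset (hΩ.mem_nhds hxΩ) subset_closure)
  · exact (h.isOuterUnitNormal hΩ
      (by rw [hΩ.frontier_eq]; exact ⟨hx, hxΩ⟩)).uniqueDiffWithinAt_closure hx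

theorem HasC2Boundary.continuousOn_outerNormal (h : HasC2Boundary Ω) (hΩ : IsOpen Ω) :
    ContinuousOn (outerNormal Ω) (frontier Ω) := by
  intro x hx
  obtain ⟨e, g, r, hr, hc⟩ := h.exists_chart hx
  exact (hc.hasFDerivWithinAt_outerNormal hΩ (Metric.mem_ball_self hr) hx).continuousWithinAt

theorem HasC2Boundary.continuousOn_gradNormal (h : HasC2Boundary Ω) (hΩ : IsOpen Ω) :
    ContinuousOn (gradNormal Ω) (frontier Ω) := by
  intro x hx
  obtain ⟨e, g, r, hr, hc⟩ := h.exists_chart hx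
  have hnC := contDiff_graphNormal hc.norm_eq hc.contDiff
  have hcn := hnC.continuous
  have hcd := hnC.continuous_fderiv one_ne_zero
  have hcont : Continuous fun y => fderiv ℝ (graphNormal e g) y
      - (innerSL ℝ (graphNormal e g y)).smulRight
        (fderiv ℝ (graphNormal e g) y (graphNormal e g y)) := by
    refine hcd.sub ?_
    exact ((ContinuousLinearMap.smulRightL ℝ _ _).continuous.comp
      ((innerSL ℝ).continuous.comp hcn)).clm_apply (hcd.clm_apply hcn)
  have heq : ∀ y ∈ Metric.ball x r, y ∈ frontier Ω → gradNormal Ω y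
      = fderiv ℝ (graphNormal e g) y - (innerSL ℝ (graphNormal e g y)).smulRight
        (fderiv ℝ (graphNormal e g) y (graphNormal e g y)) := by
    intro y hy hyf
    ext1 v
    rw [hc.gradNormal_apply hΩ hy hyf]
    rfl
  refine hcont.continuousWithinAt.congr_of_eventuallyEq ?_ (heq x (Metric.mem_ball_self hr) hx)
  filter_upwards [self_mem_nhdsWithin, mem_nhdsWithin_of_mem_nhds (Metric.ball_mem_nhds x hr)]
    with z hz hzb using heq z hzb hz

theorem finrank_orthogonal_span_singleton_of_norm_eq_one (he : ‖e‖ = 1) :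
    Module.finrank ℝ (ℝ ∙ e)ᗮ = N - 1 := by
  have h := Submodule.finrank_add_finrank_orthogonal (ℝ ∙ e)
  rw [finrank_span_singleton (norm_ne_zero_iff.1 (he ▸ one_ne_zero)),
    finrank_euclideanSpace_fin] at h
  omega

/-- Surface integrals of functions supported in a chart. -/
theorem IsGraphChart.integral_surfaceMeasure (h : IsGraphChart Ω e g x r) (hΩ : IsOpen Ω)
    {f : EuclideanSpace ℝ (Fin N) → ℝ} (hf : ∀ y ∉ Metric.ball x r, f y = 0) :
    ∫ y, f y ∂(surfaceMeasure Ω)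
      = ∫ p, ‖gradient (graphHeight e g) (graphMap e g p)‖ * f (graphMap e g p) := by
  rw [← setIntegral_range_graphMap h.norm_eq h.contDiff_one, surfaceMeasure,
    finrank_orthogonal_span_singleton_of_norm_eq_one h.norm_eq,
    ← integral_indicator isClosed_frontier.measurableSet,
    ← integral_indicator (isClosedEmbedding_graphMap
      h.contDiff.continuous).isClosed_range.measurableSet]
  congr 1
  ext y
  by_cases hy : y ∈ Metric.ball x r
  · have : y ∈ frontier Ω ↔ y ∈ range (graphMap e g) := by
      rw [h.mem_frontier_iff hΩ hy, range_graphMap h.norm_eq]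
      rfl
    by_cases hm : y ∈ frontier Ω
    · rw [indicator_of_mem hm, indicator_of_mem (this.1 hm)]
    · rw [indicator_of_notMem hm, indicator_of_notMem (mt this.2 hm)]
  · simp only [indicator, hf y hy, ite_self]

theorem HasC2Boundary.surfaceMeasure_lt_top (h : HasC2Boundary Ω) (hΩ : IsOpen Ω)
    (hb : Bornology.IsBounded Ω) : surfaceMeasure Ω univ < ∞ := by
  have hK : IsCompact (frontier Ω) :=
    (Metric.isCompact_of_isClosed_isBounded isClosed_closure hb.closure).of_isClosed_subset
      isClosed_frontier frontier_subset_closure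
  rw [surfaceMeasure, Measure.restrict_apply_univ]
  refine hK.measure_lt_top_of_nhdsWithin fun x hx => ?_
  obtain ⟨e, g, r, hr, hc⟩ := h.exists_chart hx
  refine ⟨frontier Ω ∩ Metric.ball x r,
    inter_mem_nhdsWithin _ (Metric.ball_mem_nhds x hr), ?_⟩
  have hlt := measure_range_graphMap_inter_lt_top hc.norm_eq hc.contDiff_one hK
  rw [finrank_orthogonal_span_singleton_of_norm_eq_one hc.norm_eq] at hlt
  refine (measure_mono ?_).trans_lt hlt
  rintro y ⟨hyf, hyb⟩
  refine ⟨?_, hyf⟩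
  rw [range_graphMap hc.norm_eq]
  exact (hc.mem_frontier_iff hΩ hyb).1 hyf

end Chart

/-! ### Globalization of both divergence theorems by a partition of unity. -/

section Global

variable {N : ℕ} {Ω : Set (EuclideanSpace ℝ (Fin N))}

open scoped Manifold ContDiff in
/-- A partition of unity on the closure of `Ω` whose members live inside `Ω` or in a boundary
chart. -/
theorem HasC2Boundary.exists_partition (h : HasC2Boundary Ω) (hΩ : IsOpen Ω)
    (hb : Bornology.IsBounded Ω) :
    ∃ (ι : Type) (_ : Fintype ι) (φ : ι → EuclideanSpace ℝ (Fin N) → ℝ),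
      (∀ i, ContDiff ℝ 1 (φ i)) ∧ (∀ i, HasCompactSupport (φ i)) ∧
      (∀ i, tsupport (φ i) ⊆ Ω ∨ ∃ e g x r, IsGraphChart Ω e g x r ∧
        tsupport (φ i) ⊆ Metric.ball x r) ∧
      ∀ x ∈ closure Ω, ∑ i, φ i x = 1 := by
  have hK : IsCompact (closure Ω) :=
    Metric.isCompact_of_isClosed_isBounded isClosed_closure hb.closure
  -- Boundedness of the covering sets is what gives the members of the partition compact support.
  have hU : ∀ x ∈ closure Ω, ∃ U : Set (EuclideanSpace ℝ (Fin N)), IsOpen U ∧ x ∈ U ∧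
      Bornology.IsBounded U ∧
      (U ⊆ Ω ∨ ∃ e g x r, IsGraphChart Ω e g x r ∧ U ⊆ Metric.ball x r) := by
    intro x hx
    by_cases hxΩ : x ∈ Ω
    · exact ⟨Ω, hΩ, hxΩ, hb, Or.inl subset_rfl⟩
    · obtain ⟨e, g, r, hr, hc⟩ := h.exists_chart (x := x) (by rw [hΩ.frontier_eq]; exact ⟨hx, hxΩ⟩)
      exact ⟨Metric.ball x r, Metric.isOpen_ball, Metric.mem_ball_self hr, Metric.isBounded_ball,
        Or.inr ⟨e, g, x, r, hc, subset_rfl⟩⟩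
  choose! U hUo hxU hUb hUc using hU
  obtain ⟨t, ht, htc⟩ := hK.elim_nhds_subcover U fun x hx => (hUo x hx).mem_nhds (hxU x hx)
  obtain ⟨f, hf⟩ := SmoothPartitionOfUnity.exists_isSubordinate
    𝓘(ℝ, EuclideanSpace ℝ (Fin N)) (isClosed_closure (s := Ω)) (fun i : t => U i)
    (fun i => hUo i (ht i i.2)) (by
      intro x hx
      obtain ⟨i, hi, hxi⟩ := mem_iUnion₂.1 (htc hx)
      exact mem_iUnion.2 ⟨⟨i, hi⟩, hxi⟩)
  let eqv := t.equivFin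
  refine ⟨Fin t.card, inferInstance, fun i => f (eqv.symm i), fun i => ?_, fun i => ?_,
    fun i => ?_, fun x hx => ?_⟩
  · exact (f (eqv.symm i)).contMDiff.contDiff.of_le (by exact_mod_cast le_top)
  · exact Metric.isCompact_of_isClosed_isBounded (isClosed_tsupport _)
      ((hUb _ (ht _ (eqv.symm i).2)).subset (hf _))
  · rcases hUc _ (ht _ (eqv.symm i).2) with h1 | ⟨e, g, x, r, hc, h1⟩
    · exact Or.inl ((hf _).trans h1)
    · exact Or.inr ⟨e, g, x, r, hc, (hf _).trans h1⟩
  · rw [Equiv.sum_comp eqv.symm (fun i => f i x), ← finsum_eq_sum_of_fintype]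
    exact f.sum_eq_one hx

theorem HasC2Boundary.integrable_surfaceMeasure (h : HasC2Boundary Ω) (hΩ : IsOpen Ω)
    (hb : Bornology.IsBounded Ω) {f : EuclideanSpace ℝ (Fin N) → ℝ}
    (hf : ContinuousOn f (frontier Ω)) : Integrable f (surfaceMeasure Ω) := by
  have hK : IsCompact (frontier Ω) :=
    (Metric.isCompact_of_isClosed_isBounded isClosed_closure hb.closure).of_isClosed_subset
      isClosed_frontier frontier_subset_closure
  obtain ⟨C, hC⟩ := hK.exists_bound_of_continuousOn hf
  have : IsFiniteMeasure (surfaceMeasure Ω) := ⟨h.surfaceMeasure_lt_top hΩ hb⟩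
  refine Integrable.of_bound (hf.aestronglyMeasurable isClosed_frontier.measurableSet) C ?_
  exact (ae_restrict_iff' isClosed_frontier.measurableSet).2 (Eventually.of_forall hC)

theorem integral_surfaceMeasure_congr {f f' : EuclideanSpace ℝ (Fin N) → ℝ}
    (h : ∀ x ∈ frontier Ω, f x = f' x) :
    ∫ x, f x ∂(surfaceMeasure Ω) = ∫ x, f' x ∂(surfaceMeasure Ω) :=
  setIntegral_congr_fun isClosed_frontier.measurableSet h

theorem smul_eventuallyEq_zero {E F : Type*} [TopologicalSpace E] [AddCommGroup F] [Module ℝ F]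
    {φ : E → ℝ} {x : E} (hx : x ∉ tsupport φ) (f : E → F) :
    (fun y => φ y • f y) =ᶠ[𝓝 x] fun _ => 0 := by
  filter_upwards [(isClosed_tsupport φ).isOpen_compl.mem_nhds hx] with y hy
  rw [image_eq_zero_of_notMem_tsupport hy, zero_smul]

theorem divergence_smul_eq_zero {φ : EuclideanSpace ℝ (Fin N) → ℝ}
    {x : EuclideanSpace ℝ (Fin N)} (hx : x ∉ tsupport φ)
    (F : EuclideanSpace ℝ (Fin N) → EuclideanSpace ℝ (Fin N)) :
    divergence (fun y => φ y • F y) x = 0 := by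
  rw [divergence, (smul_eventuallyEq_zero hx F).fderiv_eq]
  simp

theorem IsGraphChart.continuousOn_below {e x : EuclideanSpace ℝ (Fin N)} {g : (ℝ ∙ e)ᗮ → ℝ}
    {r : ℝ} (hc : IsGraphChart Ω e g x r) {F : Type*} [TopologicalSpace F] [Zero F]
    {f : EuclideanSpace ℝ (Fin N) → F} (hf : ContinuousOn f (closure Ω))
    {K : Set (EuclideanSpace ℝ (Fin N))} (hK : IsClosed K) (hKr : K ⊆ Metric.ball x r)
    (hfK : ∀ y ∉ K, f y = 0) : ContinuousOn f {y | graphHeight e g y ≤ 0} := by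
  intro y hy
  by_cases hyK : y ∈ K
  · have hball := Metric.isOpen_ball.mem_nhds (hKr hyK)
    refine (hf y ((hc.mem_closure_iff (hKr hyK)).2 hy)).mono_of_mem_nhdsWithin ?_
    filter_upwards [self_mem_nhdsWithin, mem_nhdsWithin_of_mem_nhds hball] with z hz hzb
    exact (hc.mem_closure_iff hzb).2 hz
  · have h0 : f =ᶠ[𝓝 y] fun _ => 0 := by
      filter_upwards [hK.isOpen_compl.mem_nhds hyK] with z hz using hfK z hz
    exact (continuousAt_const.congr h0.symm).continuousWithinAt

/-- The divergence theorem for a field multiplied by a member of the partition of unity. -/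
theorem integral_divergence_smul_eq (hΩ : IsOpen Ω)
    {φ : EuclideanSpace ℝ (Fin N) → ℝ} (hφ : ContDiff ℝ 1 φ) (hφc : HasCompactSupport φ)
    (hφΩ : tsupport φ ⊆ Ω ∨ ∃ e g x r, IsGraphChart Ω e g x r ∧ tsupport φ ⊆ Metric.ball x r)
    {F : EuclideanSpace ℝ (Fin N) → EuclideanSpace ℝ (Fin N)}
    (hFc : ContinuousOn F (closure Ω)) (hF : ContDiffOn ℝ 1 F Ω)
    (hint : IntegrableOn (divergence fun y => φ y • F y) Ω) :
    ∫ x in Ω, divergence (fun y => φ y • F y) x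
      = ∫ x, ⟪φ x • F x, outerNormal Ω x⟫_ℝ ∂(surfaceMeasure Ω) := by
  have hz : ∀ x ∉ tsupport φ, φ x • F x = 0 := fun x hx => by
    rw [image_eq_zero_of_notMem_tsupport hx, zero_smul]
  rcases hφΩ with hsub | ⟨e, g, x₀, r, hc, hsub⟩
  · have hC : ContDiff ℝ 1 fun y => φ y • F y := by
      rw [contDiff_iff_contDiffAt]
      intro x
      by_cases hx : x ∈ tsupport φ
      · exact hφ.contDiffAt.smul (hF.contDiffAt (hΩ.mem_nhds (hsub hx)))
      · exact contDiffAt_const.congr_of_eventuallyEq (smul_eventuallyEq_zero hx F)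
    have h1 : ∫ x, ⟪φ x • F x, outerNormal Ω x⟫_ℝ ∂(surfaceMeasure Ω) = 0 := by
      refine setIntegral_eq_zero_of_forall_eq_zero fun x hx => ?_
      rw [hz x fun hxt => ?_, inner_zero_left]
      rw [hΩ.frontier_eq] at hx
      exact hx.2 (hsub hxt)
    rw [h1, setIntegral_eq_integral_of_forall_compl_eq_zero
      fun x hx => divergence_smul_eq_zero (fun hxt => hx (hsub hxt)) F,
      integral_divergence_eq_zero hC hφc.smul_right]
  · have hopen : IsOpen {y | graphHeight e g y < 0} :=
      isOpen_lt hc.continuous_graphHeight continuous_const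
    have hmem : ∀ y ∈ tsupport φ, y ∈ {y | graphHeight e g y < 0} ↔ y ∈ Ω :=
      fun y hy => (hc.mem_iff y (hsub hy)).symm
    -- On the support of `φ` the region below the graph is `Ω`, and off the support the divergence
    -- vanishes, so the two bulk integrals agree.
    have hind : {y | graphHeight e g y < 0}.indicator (divergence fun y => φ y • F y)
        = Ω.indicator (divergence fun y => φ y • F y) := by
      ext y
      by_cases hy : y ∈ tsupport φ
      · by_cases hyΩ : y ∈ Ω
        · rw [indicator_of_mem hyΩ, indicator_of_mem ((hmem y hy).2 hyΩ)]
        · rw [indicator_of_notMem hyΩ, indicator_of_notMem (mt (hmem y hy).1 hyΩ)]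
      · have h0 := divergence_smul_eq_zero hy F
        rw [indicator_apply_eq_zero.2 fun _ => h0, indicator_apply_eq_zero.2 fun _ => h0]
    have hC : ContDiffOn ℝ 1 (fun y => φ y • F y) {y | graphHeight e g y < 0} := by
      intro y hy
      refine ContDiffAt.contDiffWithinAt ?_
      by_cases hyt : y ∈ tsupport φ
      · exact hφ.contDiffAt.smul (hF.contDiffAt (hΩ.mem_nhds ((hmem y hyt).1 hy)))
      · exact contDiffAt_const.congr_of_eventuallyEq (smul_eventuallyEq_zero hyt F)
    have key := setIntegral_divergence_below_graph hc.norm_eq hc.contDiff_one hC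
      (hc.continuousOn_below (hφ.continuous.continuousOn.smul hFc) (isClosed_tsupport φ) hsub hz)
      hφc hz (by
        rw [← integrable_indicator_iff hopen.measurableSet, hind,
          integrable_indicator_iff hΩ.measurableSet]
        exact hint)
    rw [← integral_indicator hopen.measurableSet, hind, integral_indicator hΩ.measurableSet] at key
    rw [key, integral_surfaceMeasure_congr (f' := fun y => ⟪φ y • F y, graphNormal e g y⟫_ℝ),
      hc.integral_surfaceMeasure hΩ]
    · refine integral_congr_ae (Eventually.of_forall fun p => ?_)
      simp only
      conv_lhs => rw [gradient_graphHeight_eq_smul hc.norm_eq hc.contDiff_one]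
      rw [real_inner_smul_left, real_inner_comm]
    · intro y hy
      rw [hz y fun hyt => hy (hsub hyt), inner_zero_left]
    · intro y hy
      by_cases hyt : y ∈ tsupport φ
      · rw [hc.outerNormal_eq hΩ (hsub hyt) hy]
      · simp only [hz y hyt, inner_zero_left]

/-- The divergence theorem for fields continuous up to the boundary whose divergence is
integrable. -/
theorem HasC2Boundary.integral_divergence_eq (h : HasC2Boundary Ω) (hΩ : IsOpen Ω)
    (hb : Bornology.IsBounded Ω) {F : EuclideanSpace ℝ (Fin N) → EuclideanSpace ℝ (Fin N)}
    (hFc : ContinuousOn F (closure Ω)) (hF : ContDiffOn ℝ 1 F Ω)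
    (hint : IntegrableOn (divergence F) Ω) :
    ∫ x in Ω, divergence F x = ∫ x, ⟪F x, outerNormal Ω x⟫_ℝ ∂(surfaceMeasure Ω) := by
  obtain ⟨ι, _, φ, hφ, hφc, hφΩ, hsum⟩ := h.exists_partition hΩ hb
  have hK : IsCompact (closure Ω) :=
    Metric.isCompact_of_isClosed_isBounded isClosed_closure hb.closure
  have hFd : ∀ x ∈ Ω, DifferentiableAt ℝ F x := fun x hx =>
    (hF.contDiffAt (hΩ.mem_nhds hx)).differentiableAt one_ne_zero
  have hφd : ∀ i x, DifferentiableAt ℝ (φ i) x := fun i x =>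
    (hφ i).differentiable one_ne_zero x
  have hints : ∀ i, IntegrableOn (divergence fun y => φ i y • F y) Ω := by
    intro i
    obtain ⟨C, hC⟩ := (hφc i).exists_bound_of_continuous (hφ i).continuous
    have h1 : IntegrableOn (fun x => φ i x * divergence F x) Ω :=
      hint.bdd_mul (hφ i).continuous.aestronglyMeasurable (Eventually.of_forall hC)
    have h2 : IntegrableOn (fun x => fderiv ℝ (φ i) x (F x)) Ω :=
      ((((hφ i).continuous_fderiv one_ne_zero).continuousOn.clm_apply hFc).integrableOn_compact
        hK).mono_set subset_closure
    exact (h1.add h2).congr_fun (fun x hx => (divergence_smul (hφd i x) (hFd x hx)).symm)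
      hΩ.measurableSet
  have hsplit : ∀ x ∈ Ω, divergence F x = ∑ i, divergence (fun y => φ i y • F y) x := by
    intro x hx
    have hev : F =ᶠ[𝓝 x] fun y => ∑ i, φ i y • F y := by
      filter_upwards [hΩ.mem_nhds hx] with y hy
      rw [← Finset.sum_smul, hsum y (subset_closure hy), one_smul]
    rw [divergence, hev.fderiv_eq, fderiv_fun_sum (A := fun i y => φ i y • F y)
      fun i _ => (hφd i x).smul (hFd x hx), map_sum]
    rfl
  rw [setIntegral_congr_fun hΩ.measurableSet hsplit, integral_finsetSum _ fun i _ => hints i,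
    integral_surfaceMeasure_congr (f' := fun x => ∑ i, ⟪φ i x • F x, outerNormal Ω x⟫_ℝ),
    integral_finsetSum]
  · exact Finset.sum_congr rfl fun i _ =>
      integral_divergence_smul_eq hΩ (hφ i) (hφc i) (hφΩ i) hFc hF (hints i)
  · intro i _
    exact h.integrable_surfaceMeasure hΩ hb (((hφ i).continuous.continuousOn.smul
      (hFc.mono frontier_subset_closure)).inner (h.continuousOn_outerNormal hΩ))
  · intro x hx
    rw [← sum_inner, ← Finset.sum_smul, hsum x (frontier_subset_closure hx), one_smul]

/-- The integrand of the tangential divergence theorem: the tangential divergence of `X` minus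
the trace of `∇ν` times the normal component of `X`. -/
noncomputable def tangentialDefect (Ω : Set (EuclideanSpace ℝ (Fin N)))
    (X : EuclideanSpace ℝ (Fin N) → EuclideanSpace ℝ (Fin N)) (x : EuclideanSpace ℝ (Fin N)) : ℝ :=
  traceL _ (fderivWithin ℝ X (closure Ω) x)
    - ⟪fderivWithin ℝ X (closure Ω) x (outerNormal Ω x), outerNormal Ω x⟫_ℝ
    - traceL _ (gradNormal Ω x) * ⟪X x, outerNormal Ω x⟫_ℝ

theorem fderivWithin_smul_eq_zero {φ : EuclideanSpace ℝ (Fin N) → ℝ}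
    {x : EuclideanSpace ℝ (Fin N)} (hx : x ∉ tsupport φ)
    (F : EuclideanSpace ℝ (Fin N) → EuclideanSpace ℝ (Fin N)) :
    fderivWithin ℝ (fun y => φ y • F y) (closure Ω) x = 0 := by
  have h0 := smul_eventuallyEq_zero hx F
  rw [(h0.filter_mono nhdsWithin_le_nhds).fderivWithin_eq h0.eq_of_nhds]
  simp

theorem HasC2Boundary.integral_tangentialDefect_smul (h : HasC2Boundary Ω) (hΩ : IsOpen Ω)
    {φ : EuclideanSpace ℝ (Fin N) → ℝ} (hφ : ContDiff ℝ 1 φ) (hφc : HasCompactSupport φ)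
    (hφΩ : tsupport φ ⊆ Ω ∨ ∃ e g x r, IsGraphChart Ω e g x r ∧ tsupport φ ⊆ Metric.ball x r)
    {X : EuclideanSpace ℝ (Fin N) → EuclideanSpace ℝ (Fin N)}
    (hX : ContDiffOn ℝ 1 X (closure Ω)) :
    ∫ x, tangentialDefect Ω (fun y => φ y • X y) x ∂(surfaceMeasure Ω) = 0 := by
  have hz : ∀ x ∉ tsupport φ, φ x • X x = 0 := fun x hx => by
    rw [image_eq_zero_of_notMem_tsupport hx, zero_smul]
  have hzd : ∀ x ∉ tsupport φ, tangentialDefect Ω (fun y => φ y • X y) x = 0 := by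
    intro x hx
    rw [tangentialDefect, fderivWithin_smul_eq_zero hx, hz x hx]
    simp
  rcases hφΩ with hsub | ⟨e, g, x₀, r, hc, hsub⟩
  · refine setIntegral_eq_zero_of_forall_eq_zero fun x hx => hzd x fun hxt => ?_
    rw [hΩ.frontier_eq] at hx
    exact hx.2 (hsub hxt)
  · have hopen : IsOpen {y | graphHeight e g y < 0} :=
      isOpen_lt hc.continuous_graphHeight continuous_const
    have hud := h.uniqueDiffOn_closure hΩ
    have hφX : ContDiffOn ℝ 1 (fun y => φ y • X y) (closure Ω) := hφ.contDiffOn.smul hX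
    have hC : ContDiffOn ℝ 1 (fun y => φ y • X y) {y | graphHeight e g y < 0} := by
      intro y hy
      refine ContDiffAt.contDiffWithinAt ?_
      by_cases hyt : y ∈ tsupport φ
      · exact hφX.contDiffAt (mem_of_superset
          (hΩ.mem_nhds ((hc.mem_iff y (hsub hyt)).2 hy)) subset_closure)
      · exact contDiffAt_const.congr_of_eventuallyEq (smul_eventuallyEq_zero hyt X)
    have key := integral_tangential_divergence_graph hc.norm_eq hc.contDiff
      (A := fderivWithin ℝ (fun y => φ y • X y) (closure Ω)) hC
      (hc.continuousOn_below hφX.continuousOn (isClosed_tsupport φ) hsub hz)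
      (hc.continuousOn_below (hφX.continuousOn_fderivWithin hud le_rfl)
        (isClosed_tsupport φ) hsub fun y hy => fderivWithin_smul_eq_zero hy X)
      (fun y hy => by
        by_cases hyt : y ∈ tsupport φ
        · exact (fderivWithin_of_mem_nhds (mem_of_superset
            (hΩ.mem_nhds ((hc.mem_iff y (hsub hyt)).2 hy)) subset_closure)).symm
        · rw [fderivWithin_smul_eq_zero hyt, (smul_eventuallyEq_zero hyt X).fderiv_eq]
          simp)
      hφc hz (fun y hy => fderivWithin_smul_eq_zero hy X)
    rw [← key, ← hc.integral_surfaceMeasure hΩ (f := fun y =>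
      traceL _ (fderivWithin ℝ (fun y => φ y • X y) (closure Ω) y)
        - ⟪fderivWithin ℝ (fun y => φ y • X y) (closure Ω) y (graphNormal e g y),
            graphNormal e g y⟫_ℝ
        - traceL _ (fderiv ℝ (graphNormal e g) y) * ⟪φ y • X y, graphNormal e g y⟫_ℝ)]
    · refine integral_surfaceMeasure_congr fun y hy => ?_
      by_cases hyt : y ∈ tsupport φ
      · rw [tangentialDefect, hc.outerNormal_eq hΩ (hsub hyt) hy,
          hc.traceL_gradNormal hΩ (hsub hyt) hy]
      · rw [hzd y hyt, fderivWithin_smul_eq_zero hyt, hz y hyt]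
        simp
    · intro y hy
      have hyt : y ∉ tsupport φ := fun hyt => hy (hsub hyt)
      rw [fderivWithin_smul_eq_zero hyt, hz y hyt]
      simp

theorem HasC2Boundary.continuousOn_tangentialDefect (h : HasC2Boundary Ω) (hΩ : IsOpen Ω)
    {X : EuclideanSpace ℝ (Fin N) → EuclideanSpace ℝ (Fin N)}
    (hX : ContDiffOn ℝ 1 X (closure Ω)) :
    ContinuousOn (tangentialDefect Ω X) (frontier Ω) := by
  have hA := (hX.continuousOn_fderivWithin (h.uniqueDiffOn_closure hΩ) le_rfl).mono
    frontier_subset_closure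
  have hν := h.continuousOn_outerNormal hΩ
  exact (((traceL _).continuous.comp_continuousOn hA).sub ((hA.clm_apply hν).inner hν)).sub
    (((traceL _).continuous.comp_continuousOn (h.continuousOn_gradNormal hΩ)).mul
      ((hX.continuousOn.mono frontier_subset_closure).inner hν))

/-- The tangential divergence theorem on the boundary of a `C²` domain. -/
theorem HasC2Boundary.integral_tangentialDefect (h : HasC2Boundary Ω) (hΩ : IsOpen Ω)
    (hb : Bornology.IsBounded Ω) {X : EuclideanSpace ℝ (Fin N) → EuclideanSpace ℝ (Fin N)}
    (hX : ContDiffOn ℝ 1 X (closure Ω)) :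
    ∫ x, tangentialDefect Ω X x ∂(surfaceMeasure Ω) = 0 := by
  obtain ⟨ι, _, φ, hφ, hφc, hφΩ, hsum⟩ := h.exists_partition hΩ hb
  have hud := h.uniqueDiffOn_closure hΩ
  have hφX : ∀ i, ContDiffOn ℝ 1 (fun y => φ i y • X y) (closure Ω) :=
    fun i => (hφ i).contDiffOn.smul hX
  have hsplit : ∀ x ∈ frontier Ω,
      tangentialDefect Ω X x = ∑ i, tangentialDefect Ω (fun y => φ i y • X y) x := by
    intro x hx
    have hxc := frontier_subset_closure hx
    have heq : ∀ y ∈ closure Ω, X y = ∑ i, φ i y • X y := by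
      intro y hy
      rw [← Finset.sum_smul, hsum y hy, one_smul]
    have hder : fderivWithin ℝ X (closure Ω) x
        = ∑ i, fderivWithin ℝ (fun y => φ i y • X y) (closure Ω) x := by
      rw [fderivWithin_congr heq (heq x hxc), fderivWithin_fun_sum (hud x hxc)
        fun i _ => (hφX i).differentiableOn one_ne_zero x hxc]
    have hX0 : ⟪X x, outerNormal Ω x⟫_ℝ = ∑ i, ⟪φ i x • X x, outerNormal Ω x⟫_ℝ := by
      rw [← sum_inner, ← heq x hxc]
    simp only [tangentialDefect]
    rw [hder, hX0, map_sum, _root_.sum_apply, sum_inner, Finset.mul_sum,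
      ← Finset.sum_sub_distrib, ← Finset.sum_sub_distrib]
  rw [integral_surfaceMeasure_congr hsplit, integral_finsetSum _ fun i _ =>
    h.integrable_surfaceMeasure hΩ hb (h.continuousOn_tangentialDefect hΩ (hφX i))]
  exact Finset.sum_eq_zero fun i _ =>
    h.integral_tangentialDefect_smul hΩ (hφ i) (hφc i) (hφΩ i) hX

end Global

/-! ### Gradient and Hessian up to the boundary, and the Laplacian of `P`. -/

section Gradient

variable {N : ℕ} {Ω : Set (EuclideanSpace ℝ (Fin N))} {u : EuclideanSpace ℝ (Fin N) → ℝ} {β : ℝ}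

theorem inner_gradClosure (x v : EuclideanSpace ℝ (Fin N)) :
    ⟪gradClosure Ω u x, v⟫_ℝ = fderivWithin ℝ u (closure Ω) x v :=
  inner_gradientWithin_left' _ _ _ _

theorem gradClosure_eq_gradient (hΩ : IsOpen Ω) {x : EuclideanSpace ℝ (Fin N)} (hx : x ∈ Ω) :
    gradClosure Ω u x = gradient u x := by
  rw [gradClosure, gradientWithin_eq_rieszL, gradient_eq_rieszL,
    fderivWithin_of_mem_nhds (mem_of_superset (hΩ.mem_nhds hx) subset_closure)]

/-- The Hessian of `u` on the closure of `Ω`, as an endomorphism. -/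
noncomputable def hessClosure (Ω : Set (EuclideanSpace ℝ (Fin N)))
    (u : EuclideanSpace ℝ (Fin N) → ℝ) (x : EuclideanSpace ℝ (Fin N)) :
    EuclideanSpace ℝ (Fin N) →L[ℝ] EuclideanSpace ℝ (Fin N) :=
  fderivWithin ℝ (gradClosure Ω u) (closure Ω) x

theorem hessClosure_eq_fderiv (hΩ : IsOpen Ω) {x : EuclideanSpace ℝ (Fin N)} (hx : x ∈ Ω) :
    hessClosure Ω u x = fderiv ℝ (gradClosure Ω u) x :=
  fderivWithin_of_mem_nhds (mem_of_superset (hΩ.mem_nhds hx) subset_closure)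

theorem contDiffOn_gradClosure (hud : UniqueDiffOn ℝ (closure Ω))
    (hu : ContDiffOn ℝ 2 u (closure Ω)) : ContDiffOn ℝ 1 (gradClosure Ω u) (closure Ω) :=
  (rieszL _).contDiff.comp_contDiffOn (hu.fderivWithin hud (by rw [one_add_one_eq_two]))

theorem continuousOn_hessClosure (hud : UniqueDiffOn ℝ (closure Ω))
    (hu : ContDiffOn ℝ 2 u (closure Ω)) : ContinuousOn (hessClosure Ω u) (closure Ω) :=
  (contDiffOn_gradClosure hud hu).continuousOn_fderivWithin hud le_rfl

theorem fderiv_gradClosure_apply_inner (hΩ : IsOpen Ω) (hu : ContDiffOn ℝ 2 u Ω)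
    {x : EuclideanSpace ℝ (Fin N)} (hx : x ∈ Ω) (v w : EuclideanSpace ℝ (Fin N)) :
    ⟪fderiv ℝ (gradClosure Ω u) x v, w⟫_ℝ = fderiv ℝ (fderiv ℝ u) x v w := by
  have hev : gradClosure Ω u =ᶠ[𝓝 x] fun y => rieszL _ (fderiv ℝ u y) := by
    filter_upwards [hΩ.mem_nhds hx] with y hy
    rw [gradClosure_eq_gradient hΩ hy, gradient_eq_rieszL]
  have hd : DifferentiableAt ℝ (fderiv ℝ u) x :=
    ((hu.contDiffAt (hΩ.mem_nhds hx)).fderiv_right (m := 1)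
      (by norm_num)).differentiableAt one_ne_zero
  have h1 := (rieszL (EuclideanSpace ℝ (Fin N))).hasFDerivAt.comp x hd.hasFDerivAt
  rw [hev.fderiv_eq, ← inner_rieszL]
  exact congrArg (fun l => ⟪l v, w⟫_ℝ) h1.fderiv

/-- Symmetry of second derivatives holds in the open set and passes to the boundary by continuity of
the Hessian; the trace is treated the same way in `traceL_hessClosure`. -/
theorem inner_hessClosure_comm (hΩ : IsOpen Ω) (hud : UniqueDiffOn ℝ (closure Ω))
    (hu : ContDiffOn ℝ 2 u (closure Ω)) {x : EuclideanSpace ℝ (Fin N)} (hx : x ∈ closure Ω)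
    (v w : EuclideanSpace ℝ (Fin N)) :
    ⟪hessClosure Ω u x v, w⟫_ℝ = ⟪hessClosure Ω u x w, v⟫_ℝ := by
  have hA := continuousOn_hessClosure hud hu
  have huΩ := hu.mono subset_closure
  have h : EqOn (fun x => ⟪hessClosure Ω u x v, w⟫_ℝ) (fun x => ⟪hessClosure Ω u x w, v⟫_ℝ) Ω := by
    intro y hy
    simp only
    rw [hessClosure_eq_fderiv hΩ hy, fderiv_gradClosure_apply_inner hΩ huΩ hy,
      fderiv_gradClosure_apply_inner hΩ huΩ hy]
    exact ((huΩ.contDiffAt (hΩ.mem_nhds hy)).isSymmSndFDerivAt (by simp)).eq v w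
  exact h.of_subset_closure ((hA.clm_apply continuousOn_const).inner continuousOn_const)
    ((hA.clm_apply continuousOn_const).inner continuousOn_const) subset_closure subset_rfl hx

namespace IsRobinTorsionSolution

theorem laplacian_gradClosure (hu : IsRobinTorsionSolution Ω β u) (hΩ : IsOpen Ω)
    {x : EuclideanSpace ℝ (Fin N)} (hx : x ∈ Ω) : divergence (gradClosure Ω u) x = N := by
  have hev : gradClosure Ω u =ᶠ[𝓝 x] gradient u := by
    filter_upwards [hΩ.mem_nhds hx] with y hy using gradClosure_eq_gradient hΩ hy
  rw [divergence, hev.fderiv_eq, ← hu.laplacian_eq x hx]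
  exact (laplacian_eq_divergence_gradient
    ((hu.contDiffOn.mono subset_closure).contDiffAt (hΩ.mem_nhds hx))).symm

theorem traceL_hessClosure (hu : IsRobinTorsionSolution Ω β u) (hΩ : IsOpen Ω)
    (hud : UniqueDiffOn ℝ (closure Ω)) {x : EuclideanSpace ℝ (Fin N)} (hx : x ∈ closure Ω) :
    traceL _ (hessClosure Ω u x) = N := by
  have h : EqOn (fun x => traceL _ (hessClosure Ω u x)) (fun _ => (N : ℝ)) Ω := by
    intro y hy
    simp only
    rw [hessClosure_eq_fderiv hΩ hy]
    exact hu.laplacian_gradClosure hΩ hy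
  exact h.of_subset_closure
    ((traceL _).continuous.comp_continuousOn (continuousOn_hessClosure hud hu.contDiffOn))
    continuousOn_const subset_closure subset_rfl hx

theorem contDiffOn_interior (hu : IsRobinTorsionSolution Ω β u) (hΩ : IsOpen Ω) :
    ContDiffOn ℝ (⊤ : ℕ∞) u Ω :=
  contDiffOn_of_laplacian_eq_const hΩ (hu.contDiffOn.mono subset_closure) hu.laplacian_eq

/-- Two derivatives of the gradient are three of `u`, one more than assumed; interior smoothness
supplies it. -/
theorem contDiffOn_gradClosure_interior (hu : IsRobinTorsionSolution Ω β u) (hΩ : IsOpen Ω) :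
    ContDiffOn ℝ 2 (gradClosure Ω u) Ω := by
  have h1 : ContDiffOn ℝ 2 (fderiv ℝ u) Ω :=
    (hu.contDiffOn_interior hΩ).fderiv_of_isOpen hΩ (WithTop.coe_le_coe.2 le_top)
  refine ((rieszL _).contDiff.comp_contDiffOn h1).congr fun x hx => ?_
  rw [gradClosure_eq_gradient hΩ hx, gradient_eq_rieszL]
  rfl

theorem contDiffOn_pFunction (hu : IsRobinTorsionSolution Ω β u) (hΩ : IsOpen Ω) :
    ContDiffOn ℝ 2 (pFunction Ω u) Ω :=
  (contDiffOn_const.mul ((hu.contDiffOn_gradClosure_interior hΩ).norm_sq ℝ)).sub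
    (hu.contDiffOn.mono subset_closure)

theorem gradient_pFunction (hu : IsRobinTorsionSolution Ω β u) (hΩ : IsOpen Ω)
    (hud : UniqueDiffOn ℝ (closure Ω)) {x : EuclideanSpace ℝ (Fin N)} (hx : x ∈ Ω) :
    gradient (pFunction Ω u) x
      = hessClosure Ω u x (gradClosure Ω u x) - gradClosure Ω u x := by
  have hw : HasFDerivAt (gradClosure Ω u) (hessClosure Ω u x) x := by
    rw [hessClosure_eq_fderiv hΩ hx]
    exact (((hu.contDiffOn_gradClosure_interior hΩ).contDiffAt
      (hΩ.mem_nhds hx)).differentiableAt two_ne_zero).hasFDerivAt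
  have hud' : HasFDerivAt u (fderiv ℝ u x) x :=
    (((hu.contDiffOn.mono subset_closure).contDiffAt
      (hΩ.mem_nhds hx)).differentiableAt two_ne_zero).hasFDerivAt
  have hP : HasFDerivAt (pFunction Ω u) _ x := (hw.norm_sq.const_mul (1 / 2)).sub hud'
  refine ext_inner_right ℝ fun v => ?_
  rw [inner_gradient_left', hP.fderiv, inner_sub_left,
    inner_hessClosure_comm hΩ hud hu.contDiffOn (subset_closure hx),
    real_inner_comm, gradClosure_eq_gradient hΩ hx, inner_gradient_left']
  simp

theorem laplacian_pFunction (hu : IsRobinTorsionSolution Ω β u) (hΩ : IsOpen Ω)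
    (hud : UniqueDiffOn ℝ (closure Ω)) {x : EuclideanSpace ℝ (Fin N)} (hx : x ∈ Ω) :
    Laplacian.laplacian (pFunction Ω u) x
      = divergence (fun y => hessClosure Ω u y (gradClosure Ω u y) - gradClosure Ω u y) x := by
  rw [laplacian_eq_divergence_gradient
    ((hu.contDiffOn_pFunction hΩ).contDiffAt (hΩ.mem_nhds hx)), divergence, divergence]
  congr 1
  refine EventuallyEq.fderiv_eq ?_
  filter_upwards [hΩ.mem_nhds hx] with y hy using hu.gradient_pFunction hΩ hud hy

theorem contDiffOn_hessClosure_interior (hu : IsRobinTorsionSolution Ω β u) (hΩ : IsOpen Ω) :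
    ContDiffOn ℝ 1 (hessClosure Ω u) Ω :=
  ((hu.contDiffOn_gradClosure_interior hΩ).fderiv_of_isOpen hΩ
    (by rw [one_add_one_eq_two])).congr fun _ hx => hessClosure_eq_fderiv hΩ hx

/-- Third derivatives of `u` enter only through the derivative of `tr A` along `∇u`, which is zero
since `tr A = N`. The remaining expression has second derivatives only, hence extends continuously
to the closure and is integrable. -/
theorem divergence_gradient_pFunction (hu : IsRobinTorsionSolution Ω β u) (hΩ : IsOpen Ω)
    {x : EuclideanSpace ℝ (Fin N)} (hx : x ∈ Ω) :
    divergence (fun y => hessClosure Ω u y (gradClosure Ω u y) - gradClosure Ω u y) x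
      = traceL _ ((hessClosure Ω u x).comp (hessClosure Ω u x)) - N := by
  have hwC := (hu.contDiffOn_gradClosure_interior hΩ).contDiffAt (hΩ.mem_nhds hx)
  have hw : HasFDerivAt (gradClosure Ω u) (hessClosure Ω u x) x := by
    rw [hessClosure_eq_fderiv hΩ hx]
    exact (hwC.differentiableAt two_ne_zero).hasFDerivAt
  have hA : HasFDerivAt (hessClosure Ω u) (fderiv ℝ (hessClosure Ω u) x) x :=
    (((hu.contDiffOn_hessClosure_interior hΩ).contDiffAt
      (hΩ.mem_nhds hx)).differentiableAt one_ne_zero).hasFDerivAt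
  have hev : hessClosure Ω u =ᶠ[𝓝 x] fderiv ℝ (gradClosure Ω u) := by
    filter_upwards [hΩ.mem_nhds hx] with y hy using hessClosure_eq_fderiv hΩ hy
  -- Symmetry of the second derivative of the gradient: `(∂ᵥA)∇u` equals the derivative of `A` along
  -- `∇u`, applied to `v`. Its trace in `v` is therefore a derivative of `tr A`.
  have hsymm : (fderiv ℝ (hessClosure Ω u) x).flip (gradClosure Ω u x)
      = fderiv ℝ (hessClosure Ω u) x (gradClosure Ω u x) := by
    ext1 v
    rw [ContinuousLinearMap.flip_apply, hev.fderiv_eq]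
    exact (hwC.isSymmSndFDerivAt (by simp)).eq _ _
  have htr : traceL _ (fderiv ℝ (hessClosure Ω u) x (gradClosure Ω u x)) = 0 := by
    have h1 : HasFDerivAt (fun y => traceL _ (hessClosure Ω u y))
        ((traceL _).comp (fderiv ℝ (hessClosure Ω u) x)) x :=
      (traceL (EuclideanSpace ℝ (Fin N))).hasFDerivAt.comp x hA
    have h2 : (fun y => traceL _ (hessClosure Ω u y)) =ᶠ[𝓝 x] fun _ => (N : ℝ) := by
      filter_upwards [hΩ.mem_nhds hx] with y hy
      rw [hessClosure_eq_fderiv hΩ hy]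
      exact hu.laplacian_gradClosure hΩ hy
    have h3 := h1.unique ((hasFDerivAt_const (N : ℝ) x).congr_of_eventuallyEq h2)
    exact congrArg (fun l => l (gradClosure Ω u x)) h3
  have hN : traceL _ (hessClosure Ω u x) = N := by
    rw [hessClosure_eq_fderiv hΩ hx]
    exact hu.laplacian_gradClosure hΩ hx
  have hV : HasFDerivAt
      (fun y => hessClosure Ω u y (gradClosure Ω u y) - gradClosure Ω u y) _ x :=
    (hA.clm_apply hw).sub hw
  rw [divergence, HasFDerivAt.fderiv hV, map_sub, map_add, hsymm, htr, hN, add_zero]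

end IsRobinTorsionSolution

end Gradient

/-! ### Boundary identities for solutions of the Robin problem. -/

section Boundary

variable {N : ℕ} {Ω : Set (EuclideanSpace ℝ (Fin N))} {u : EuclideanSpace ℝ (Fin N) → ℝ} {β : ℝ}
  {x : EuclideanSpace ℝ (Fin N)}

theorem HasC2Boundary.norm_outerNormal (h : HasC2Boundary Ω) (hΩ : IsOpen Ω)
    (hx : x ∈ frontier Ω) : ‖outerNormal Ω x‖ = 1 :=
  (h.isOuterUnitNormal hΩ hx).1

theorem HasC2Boundary.inner_tangentialGrad_outerNormal (h : HasC2Boundary Ω) (hΩ : IsOpen Ω)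
    (hx : x ∈ frontier Ω) : ⟪tangentialGrad Ω u x, outerNormal Ω x⟫_ℝ = 0 := by
  rw [tangentialGrad, inner_sub_left, real_inner_smul_left, real_inner_self_eq_norm_sq,
    h.norm_outerNormal hΩ hx, normalDeriv]
  ring

/-- Tangential differentiation of the Robin condition. -/
theorem IsRobinTorsionSolution.inner_hessClosure_tangentialGrad
    (hu : IsRobinTorsionSolution Ω β u) (h : HasC2Boundary Ω) (hΩ : IsOpen Ω)
    (hx : x ∈ frontier Ω) :
    ⟪hessClosure Ω u x (tangentialGrad Ω u x), outerNormal Ω x⟫_ℝ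
      = -⟪gradNormal Ω x (tangentialGrad Ω u x), tangentialGrad Ω u x⟫_ℝ
        - β * ‖tangentialGrad Ω u x‖ ^ 2 := by
  obtain ⟨e, g, r, hr, hc⟩ := h.exists_chart hx
  have hxb := Metric.mem_ball_self (x := x) hr
  have hxc := frontier_subset_closure hx
  have hud := h.uniqueDiffOn_closure hΩ
  have hn := hc.outerNormal_eq hΩ hxb hx
  set τ := tangentialGrad Ω u x with hτ
  set n := graphNormal e g with hndef
  have hτn : ⟪τ, n x⟫_ℝ = 0 := by
    rw [← hn]
    exact h.inner_tangentialGrad_outerNormal hΩ hx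
  have hw : HasFDerivWithinAt (gradClosure Ω u) (hessClosure Ω u x) (frontier Ω) x :=
    ((contDiffOn_gradClosure hud hu.contDiffOn).differentiableOn one_ne_zero x
      hxc).hasFDerivWithinAt.mono frontier_subset_closure
  have huD : HasFDerivWithinAt u (fderivWithin ℝ u (closure Ω) x) (frontier Ω) x :=
    (hu.contDiffOn.differentiableOn two_ne_zero x hxc).hasFDerivWithinAt.mono
      frontier_subset_closure
  have hsum := (hw.inner ℝ (hc.hasFDerivWithinAt_outerNormal hΩ hxb hx)).add (huD.const_mul β)
  have hzero : HasFDerivWithinAt (fun y => ⟪gradClosure Ω u y, outerNormal Ω y⟫_ℝ + β * u y)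
      (0 : EuclideanSpace ℝ (Fin N) →L[ℝ] ℝ) (frontier Ω) x :=
    (hasFDerivWithinAt_const (0 : ℝ) x (frontier Ω)).congr (fun y hy => hu.robin y hy)
      (hu.robin x hx)
  -- The Robin expression vanishes on the frontier, so `0` is one of its derivatives there. The
  -- product rule gives another, and the two agree on the tangent vector `τ`.
  have key := hc.hasFDerivWithinAt_frontier_unique hΩ hxb hx hsum hzero (v := τ)
    (by rw [real_inner_comm]; exact hτn)
  simp [← inner_gradClosure] at key
  rw [hn] at key
  have hwτ : gradClosure Ω u x = τ + normalDeriv Ω u x • n x := by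
    rw [hτ, tangentialGrad, hn, sub_add_cancel]
  have hgrad : gradNormal Ω x τ = fderiv ℝ n x τ := by
    rw [hc.gradNormal_apply hΩ hxb hx, real_inner_comm, hτn, zero_smul, sub_zero]
  have h1 : ⟪gradClosure Ω u x, fderiv ℝ n x τ⟫_ℝ = ⟪gradNormal Ω x τ, τ⟫_ℝ := by
    rw [hwτ, inner_add_left, real_inner_smul_left, real_inner_comm (fderiv ℝ n x τ) (n x),
      inner_fderiv_graphNormal_self hc.norm_eq hc.contDiff, hgrad, real_inner_comm]
    ring
  have h2 : ⟪gradClosure Ω u x, τ⟫_ℝ = ‖τ‖ ^ 2 := by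
    rw [hwτ, inner_add_left, real_inner_smul_left, real_inner_comm τ (n x), hτn,
      real_inner_self_eq_norm_sq]
    ring
  rw [hn]
  rw [h1, h2] at key
  linarith

/-- The field `u∇u` is chosen for the term `u⟨Aν, ν⟩`: by the Robin condition, `β` times this
identity contains the product of `q` and `⟨Aν, ν⟩` that occurs in `⟨∇P, ν⟩`. -/
theorem IsRobinTorsionSolution.tangentialDefect_smul_gradClosure
    (hu : IsRobinTorsionSolution Ω β u) (h : HasC2Boundary Ω) (hΩ : IsOpen Ω)
    (hx : x ∈ frontier Ω) :
    tangentialDefect Ω (fun y => u y • gradClosure Ω u y) x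
      = N * u x + ‖gradClosure Ω u x‖ ^ 2
        - u x * ⟪hessClosure Ω u x (outerNormal Ω x), outerNormal Ω x⟫_ℝ
        - normalDeriv Ω u x ^ 2
        - traceL _ (gradNormal Ω x) * (u x * normalDeriv Ω u x) := by
  have hxc := frontier_subset_closure hx
  have hud := h.uniqueDiffOn_closure hΩ
  have hD : fderivWithin ℝ (fun y => u y • gradClosure Ω u y) (closure Ω) x
      = u x • hessClosure Ω u x
        + (fderivWithin ℝ u (closure Ω) x).smulRight (gradClosure Ω u x) :=
    fderivWithin_fun_smul (hud x hxc) (hu.contDiffOn.differentiableOn two_ne_zero x hxc)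
      ((contDiffOn_gradClosure hud hu.contDiffOn).differentiableOn one_ne_zero x hxc)
  rw [tangentialDefect, hD, map_add, map_smul, traceL_smulRight, hu.traceL_hessClosure hΩ hud hxc,
    ← inner_gradClosure, real_inner_self_eq_norm_sq, add_apply,
    smul_apply, ContinuousLinearMap.smulRight_apply,
    ← inner_gradClosure, inner_add_left, real_inner_smul_left, real_inner_smul_left,
    real_inner_smul_left, smul_eq_mul, normalDeriv]
  ring

/-- When the boundary has zero measure, division by zero makes `refRadius` equal to `0`, but the
integral is then zero as well. Positivity of the surface area is thus never needed. -/
theorem integral_eq_refRadius_mul (hfin : surfaceMeasure Ω univ < ∞)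
    {q : EuclideanSpace ℝ (Fin N) → ℝ}
    (hq : ∫ x, q x ∂(surfaceMeasure Ω)
      = N * (volume : Measure (EuclideanSpace ℝ (Fin N))).real Ω) :
    ∫ x, q x ∂(surfaceMeasure Ω) = refRadius Ω * (surfaceMeasure Ω).real univ := by
  by_cases h0 : (surfaceMeasure Ω).real univ = 0
  · have : surfaceMeasure Ω = 0 := by
      rw [measureReal_def, ENNReal.toReal_eq_zero_iff] at h0
      exact Measure.measure_univ_eq_zero.1 (h0.resolve_right hfin.ne)
    rw [h0, mul_zero, this, integral_zero_measure]
  · rw [hq, refRadius, div_mul_cancel₀ _ h0]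

end Boundary

/-! ### The integral identity. -/

theorem mainTheorem3 (N : ℕ) (hN : 2 ≤ N) (Ω : Set (EuclideanSpace ℝ (Fin N)))
    (hΩ_open : IsOpen Ω) (hΩ_conn : IsConnected Ω) (hΩ_bdd : Bornology.IsBounded Ω)
    (hΩ_C2 : HasC2Boundary Ω) (β : ℝ) (hβ : β ≠ 0)
    (u : EuclideanSpace ℝ (Fin N) → ℝ) (hu : IsRobinTorsionSolution Ω β u)
    (hSR : ∀ x ∈ frontier Ω,
      ‖gradClosure Ω u x‖ ^ 2 + 2 * N * u x - 2 * β ^ 2 * u x ^ 2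
          + ((N : ℝ) - 1) * β * u x ^ 2 * meanCurvature Ω x
        = -(refRadius Ω) ^ 2 - refRadius Ω * (((N : ℝ) + 1) / β)) :
    ContDiffOn ℝ 2 (pFunction Ω u) Ω ∧
    IntegrableOn (Laplacian.laplacian (pFunction Ω u)) Ω volume ∧
    Integrable (fun x => (normalDeriv Ω u x - refRadius Ω) ^ 2) (surfaceMeasure Ω) ∧
    Integrable (fun x => ⟪gradNormal Ω x (tangentialGrad Ω u x), tangentialGrad Ω u x⟫_ℝ)
      (surfaceMeasure Ω) ∧
    Integrable (fun x => ‖tangentialGrad Ω u x‖ ^ 2) (surfaceMeasure Ω) ∧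
    (∫ x in Ω, Laplacian.laplacian (pFunction Ω u) x)
        + β * ∫ x, (normalDeriv Ω u x - refRadius Ω) ^ 2 ∂(surfaceMeasure Ω)
      = -(∫ x, ⟪gradNormal Ω x (tangentialGrad Ω u x), tangentialGrad Ω u x⟫_ℝ
            ∂(surfaceMeasure Ω))
        - β * ∫ x, ‖tangentialGrad Ω u x‖ ^ 2 ∂(surfaceMeasure Ω) := by
  have hud := hΩ_C2.uniqueDiffOn_closure hΩ_open
  have hK : IsCompact (closure Ω) :=
    Metric.isCompact_of_isClosed_isBounded isClosed_closure hΩ_bdd.closure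
  have hfin := hΩ_C2.surfaceMeasure_lt_top hΩ_open hΩ_bdd
  have : IsFiniteMeasure (surfaceMeasure Ω) := ⟨hfin⟩
  have hwC := contDiffOn_gradClosure hud hu.contDiffOn
  have hAc := continuousOn_hessClosure hud hu.contDiffOn
  have hνc := hΩ_C2.continuousOn_outerNormal hΩ_open
  have hSc := hΩ_C2.continuousOn_gradNormal hΩ_open
  have hwf := hwC.continuousOn.mono frontier_subset_closure
  have hqc : ContinuousOn (normalDeriv Ω u) (frontier Ω) := hwf.inner hνc
  have hτc : ContinuousOn (tangentialGrad Ω u) (frontier Ω) := hwf.sub (hqc.smul hνc)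
  set R := refRadius Ω with hR
  set V := fun y => hessClosure Ω u y (gradClosure Ω u y) - gradClosure Ω u y with hV
  have hVc : ContinuousOn V (closure Ω) := (hAc.clm_apply hwC.continuousOn).sub hwC.continuousOn
  have hVC : ContDiffOn ℝ 1 V Ω :=
    ((hu.contDiffOn_hessClosure_interior hΩ_open).clm_apply (hwC.mono subset_closure)).sub
      (hwC.mono subset_closure)
  have hVi : IntegrableOn (divergence V) Ω := by
    have hc : ContinuousOn (fun x => traceL _ ((hessClosure Ω u x).comp (hessClosure Ω u x))
        - (N : ℝ)) (closure Ω) :=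
      ((traceL _).continuous.comp_continuousOn (hAc.clm_comp hAc)).sub continuousOn_const
    exact ((hc.integrableOn_compact hK).mono_set subset_closure).congr_fun
      (fun x hx => (hu.divergence_gradient_pFunction hΩ_open hx).symm) hΩ_open.measurableSet
  have hLap : EqOn (Laplacian.laplacian (pFunction Ω u)) (divergence V) Ω :=
    fun x hx => hu.laplacian_pFunction hΩ_open hud hx
  have hi1 : Integrable (fun x => (normalDeriv Ω u x - R) ^ 2) (surfaceMeasure Ω) :=
    hΩ_C2.integrable_surfaceMeasure hΩ_open hΩ_bdd ((hqc.sub continuousOn_const).pow 2)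
  have hi2 : Integrable (fun x => ⟪gradNormal Ω x (tangentialGrad Ω u x),
      tangentialGrad Ω u x⟫_ℝ) (surfaceMeasure Ω) :=
    hΩ_C2.integrable_surfaceMeasure hΩ_open hΩ_bdd ((hSc.clm_apply hτc).inner hτc)
  have hi3 : Integrable (fun x => ‖tangentialGrad Ω u x‖ ^ 2) (surfaceMeasure Ω) :=
    hΩ_C2.integrable_surfaceMeasure hΩ_open hΩ_bdd (hτc.norm.pow 2)
  refine ⟨hu.contDiffOn_pFunction hΩ_open, hVi.congr_fun hLap.symm hΩ_open.measurableSet,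
    hi1, hi2, hi3, ?_⟩
  have hiV : Integrable (fun x => ⟪V x, outerNormal Ω x⟫_ℝ) (surfaceMeasure Ω) :=
    hΩ_C2.integrable_surfaceMeasure hΩ_open hΩ_bdd
      ((hVc.mono frontier_subset_closure).inner hνc)
  have hiq : Integrable (normalDeriv Ω u) (surfaceMeasure Ω) :=
    hΩ_C2.integrable_surfaceMeasure hΩ_open hΩ_bdd hqc
  have hX : ContDiffOn ℝ 1 (fun y => u y • gradClosure Ω u y) (closure Ω) :=
    (hu.contDiffOn.of_le one_le_two).smul hwC
  have hiD : Integrable (tangentialDefect Ω fun y => u y • gradClosure Ω u y)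
      (surfaceMeasure Ω) :=
    hΩ_C2.integrable_surfaceMeasure hΩ_open hΩ_bdd
      (hΩ_C2.continuousOn_tangentialDefect hΩ_open hX)
  have hdivV := hΩ_C2.integral_divergence_eq hΩ_open hΩ_bdd hVc hVC hVi
  have hdivw : ∫ x, normalDeriv Ω u x ∂(surfaceMeasure Ω)
      = R * (surfaceMeasure Ω).real univ := by
    refine integral_eq_refRadius_mul hfin ?_
    have hN' : EqOn (divergence (gradClosure Ω u)) (fun _ => (N : ℝ)) Ω :=
      fun x hx => hu.laplacian_gradClosure hΩ_open hx
    have hint : IntegrableOn (divergence (gradClosure Ω u)) Ω :=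
      IntegrableOn.congr_fun (integrableOn_const hΩ_bdd.measure_lt_top.ne) hN'.symm
        hΩ_open.measurableSet
    have := hΩ_C2.integral_divergence_eq hΩ_open hΩ_bdd hwC.continuousOn
      (hwC.mono subset_closure) hint
    rw [setIntegral_congr_fun hΩ_open.measurableSet hN', setIntegral_const, smul_eq_mul,
      mul_comm] at this
    exact this.symm
  have hdefect := hΩ_C2.integral_tangentialDefect hΩ_open hΩ_bdd hX
  have hN1 : (N : ℝ) - 1 ≠ 0 := by
    have : (2 : ℝ) ≤ N := by exact_mod_cast hN
    linarith
  -- All terms of the identity, moved to one side and with `ΔP` replaced by its flux, equal an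
  -- affine function of `q` plus `β` times the tangential defect. Since `∫ q = R|∂Ω|` and `-(N + 1 +
  -- 2βR)R + 2βR² + R(N + 1) = 0`, the affine part integrates to zero.
  have hpt : ∀ x ∈ frontier Ω,
      ⟪V x, outerNormal Ω x⟫_ℝ + β * (normalDeriv Ω u x - R) ^ 2
        + ⟪gradNormal Ω x (tangentialGrad Ω u x), tangentialGrad Ω u x⟫_ℝ
        + β * ‖tangentialGrad Ω u x‖ ^ 2
      = -(N + 1 + 2 * β * R) * normalDeriv Ω u x + (2 * β * R ^ 2 + R * (N + 1))
        + β * tangentialDefect Ω (fun y => u y • gradClosure Ω u y) x := by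
    intro x hx
    have hrob := hu.robin x hx
    have hSRx := hSR x hx
    have hH : ((N : ℝ) - 1) * meanCurvature Ω x = traceL _ (gradNormal Ω x) := by
      rw [meanCurvature, traceL_apply, mul_div_cancel₀ _ hN1]
    have hAw : ⟪hessClosure Ω u x (gradClosure Ω u x), outerNormal Ω x⟫_ℝ
        = ⟪hessClosure Ω u x (tangentialGrad Ω u x), outerNormal Ω x⟫_ℝ
          + normalDeriv Ω u x
            * ⟪hessClosure Ω u x (outerNormal Ω x), outerNormal Ω x⟫_ℝ := by
      have : gradClosure Ω u x = tangentialGrad Ω u x + normalDeriv Ω u x • outerNormal Ω x := by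
        rw [tangentialGrad, sub_add_cancel]
      conv_lhs => rw [this]
      rw [map_add, map_smul, inner_add_left, real_inner_smul_left]
    have hVν : ⟪V x, outerNormal Ω x⟫_ℝ
        = ⟪hessClosure Ω u x (gradClosure Ω u x), outerNormal Ω x⟫_ℝ - normalDeriv Ω u x := by
      rw [hV, inner_sub_left, normalDeriv]
    rw [hVν, hAw, hu.inner_hessClosure_tangentialGrad hΩ_C2 hΩ_open hx,
      hu.tangentialDefect_smul_gradClosure hΩ_C2 hΩ_open hx, ← hH]
    have hq : normalDeriv Ω u x = -(β * u x) := by linarith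
    rw [hq]
    -- Multiplying the overdetermined condition by `β` clears the denominator in `C`; this is where
    -- `β ≠ 0` enters.
    have hSR' : β * (‖gradClosure Ω u x‖ ^ 2 + 2 * N * u x - 2 * β ^ 2 * u x ^ 2
          + ((N : ℝ) - 1) * β * u x ^ 2 * meanCurvature Ω x)
        = -(β * R ^ 2) - R * (N + 1) := by
      rw [hSRx]
      field_simp
    linear_combination (-1) * hSR'
  have hint := integral_surfaceMeasure_congr hpt
  have hs1 : Integrable (fun x => ⟪V x, outerNormal Ω x⟫_ℝ
      + β * (normalDeriv Ω u x - R) ^ 2) (surfaceMeasure Ω) := hiV.add (hi1.const_mul β)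
  have hs2 : Integrable (fun x => ⟪V x, outerNormal Ω x⟫_ℝ + β * (normalDeriv Ω u x - R) ^ 2
      + ⟪gradNormal Ω x (tangentialGrad Ω u x), tangentialGrad Ω u x⟫_ℝ) (surfaceMeasure Ω) :=
    hs1.add hi2
  have hs3 : Integrable (fun x => -(N + 1 + 2 * β * R) * normalDeriv Ω u x
      + (2 * β * R ^ 2 + R * (N + 1))) (surfaceMeasure Ω) :=
    (hiq.const_mul _).add (integrable_const _)
  rw [integral_add hs2 (hi3.const_mul β), integral_add hs1 hi2,
    integral_add hiV (hi1.const_mul β), integral_add hs3 (hiD.const_mul β),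
    integral_add (hiq.const_mul _) (integrable_const _), integral_const_mul, integral_const_mul,
    integral_const_mul, integral_const_mul, hdivw, hdefect, integral_const, smul_eq_mul,
    ← hdivV] at hint
  rw [setIntegral_congr_fun hΩ_open.measurableSet hLap]
  linear_combination hint
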